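/- Let $\mathfrak g\neq 0$ and $\mathfrak h$ be complex separable Hilbert spaces equipped with complex conjugations $J$ (antilinear isometric involutions), write $\tilde B=JB^\dagger J$ for the transpose of a bounded operator, and put $\mathcal H=\mathfrak g\otimes\mathfrak h$ (Hilbert space tensor product). Let $\Phi,\Psi:\mathcal B(\mathfrak h)\to\mathcal B(\mathfrak g)$ be quantum operations, i.e. normal completely positive linear maps with $\Phi(1)\le 1$, $\Psi(1)\le 1$, having bounded operational densities: positive operators $\Phi_\tau,\Psi_\tau\in\mathcal B(\mathcal H)$ such that $\Phi(B)=\operatorname{Tr}_{\mathfrak h}[(1_{\mathfrak g}\otimes\tilde B)\Phi_\tau]$ and $\Psi(B)=\operatorname{Tr}_{\mathfrak h}[(1_{\mathfrak g}\otimes\tilde B)\Psi_\tau]$ for all $B\in\mathcal B(\mathfrak h)$. Let $\mathcal S(\mathfrak g)$ be the set of normal states $\varrho$ on $\mathcal B(\mathfrak g)$, with density operators $\rho$ determined by $\varrho(A)=\operatorname{Tr}(A\tilde\rho)$. A purification of $\Phi_\tau$ is an operator $\Gamma\in\mathcal B(\mathcal H)$ with $\Gamma^\dagger\Gamma=\Phi_\tau$,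 and likewise for $\Psi_\tau$. For $A\in\mathcal B(\mathcal H)$ put $c(A;\rho)=\tfrac12\operatorname{Tr}\big(A(\rho\otimes 1_{\mathfrak h})A^\dagger\big)$, and define $$d_H^2(\Phi,\Psi)=\tfrac12\inf_{\Gamma^\dagger\Gamma=\Phi_\tau,\;\Upsilon^\dagger\Upsilon=\Psi_\tau}\big\|\operatorname{Tr}_{\mathfrak h}(\Gamma-\Upsilon)^\dagger(\Gamma-\Upsilon)\big\|,\qquad d_H^2(\Phi,\Psi)(\varrho)=\inf_{\Gamma^\dagger\Gamma=\Phi_\tau,\;\Upsilon^\dagger\Upsilon=\Psi_\tau}c(\Gamma-\Upsilon;\rho).$$ Suppose that $\varrho[\Phi(1)]$ and $\varrho[\Psi(1)]$ do not depend on $\varrho\in\mathcal S(\mathfrak g)$. Then $$d_H^2(\Phi,\Psi)=\inf_{\Gamma^\dagger\Gamma=\Phi_\tau,\;\Upsilon^\dagger\Upsilon=\Psi_\tau}\;\sup_{\varrho\in\mathcal S(\mathfrak g)}c(\Gamma-\Upsilon;\rho)=\sup_{\varrho\in\mathcal S(\mathfrak g)}d_H^2(\Phi,\Psi)(\varrho),$$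 so the infimum and the supremum can be interchanged. Moreover $$d_H^2(\Phi,\Psi)+\sqrt{\|\Phi\|\,\|\Psi\|}\,f(\Phi,\Psi)=\tfrac12\big(\|\Phi\|+\|\Psi\|\big),$$ where $$f(\Phi,\Psi)=\inf_{\varrho\in\mathcal S(\mathfrak g)}\;\sup_{\Upsilon^\dagger\Upsilon=\Psi_\tau}\frac{\operatorname{Re}\operatorname{Tr}\big[\Upsilon(\rho\otimes 1_{\mathfrak h})\Phi_\tau^{1/2}\big]}{\sqrt{\varrho[\Phi(1)]}\sqrt{\varrho[\Psi(1)]}}$$ is the minimax fidelity (the trace equals $\operatorname{Tr}[\Phi_\tau^{1/2}\Upsilon(\rho\otimes 1_{\mathfrak h})]$ whenever the latter operator is trace class; the fraction is read as $0$ if its denominator vanishes). In particular, if $\Phi$ and $\Psi$ are channels, i.e. $\Phi(1)=\Psi(1)=1$, then $d_H^2(\Phi,\Psi)=1-f(\Phi,\Psi)$. -/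

import Mathlib

open scoped TensorProduct CStarAlgebra ComplexOrder

noncomputable section

namespace QOp

universe u v

section Trace

variable {E : Type u} [NormedAddCommGroup E] [InnerProductSpace ℂ E] [CompleteSpace E]

/-- A fixed orthonormal (Hilbert) basis of the Hilbert space `E`. -/
def stdBasis (E : Type u) [NormedAddCommGroup E] [InnerProductSpace ℂ E] [CompleteSpace E] :
    HilbertBasis (exists_hilbertBasis ℂ E).choose ℂ E :=
  (exists_hilbertBasis ℂ E).choose_spec.choose

/-- `T` is trace class: `Tr |T| < ∞`, where `|T| = (T† T)^{1/2}`. -/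
def IsTraceClass (T : E →L[ℂ] E) : Prop :=
  Summable fun i => inner ℂ (stdBasis E i) (CFC.abs T (stdBasis E i))

/-- The trace of an operator, computed in a fixed orthonormal basis
(on trace-class operators the value does not depend on the basis). -/
def trace (T : E →L[ℂ] E) : ℂ :=
  ∑' i, inner ℂ (stdBasis E i) (T (stdBasis E i))

/-- A complex conjugation on `E`: an antilinear isometric involution `J`. -/
structure Conjugation (E : Type u) [NormedAddCommGroup E] [InnerProductSpace ℂ E] where
  /-- the underlying antilinear isometry -/
  J : E ≃ₗᵢ⋆[ℂ] E
  J_J : ∀ x, J (J x) = x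

/-- The transpose `B~ = J B† J` of a bounded operator. -/
def transpose (C : Conjugation E) (B : E →L[ℂ] E) : E →L[ℂ] E :=
  (C.J.toContinuousLinearEquiv : E →L⋆[ℂ] E).comp
    ((ContinuousLinearMap.adjoint B).comp (C.J.toContinuousLinearEquiv : E →L⋆[ℂ] E))

/-- Normal states on `B(E)`, given by their density operators: positive trace-class operators
of unit trace. -/
structure NormalState (E : Type u) [NormedAddCommGroup E] [InnerProductSpace ℂ E]
    [CompleteSpace E] where
  /-- the density operator `ρ` -/
  density : E →L[ℂ] E
  nonneg : 0 ≤ density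
  traceClass : IsTraceClass density
  trace_eq_one : trace density = 1

/-- The value `ϱ(A) = (A, ρ) = Tr (A ρ~)` of the normal state `ϱ` with density operator `ρ`. -/
def NormalState.eval (C : Conjugation E) (ρ : NormalState E) (A : E →L[ℂ] E) : ℂ :=
  trace (A ∘L transpose C ρ.density)

end Trace

section Tensor

/-- The Hilbert space tensor product `g ⊗ h` (the completed algebraic tensor product). -/
abbrev HTensor (g : Type u) (h : Type v) [NormedAddCommGroup g] [InnerProductSpace ℂ g]
    [NormedAddCommGroup h] [InnerProductSpace ℂ h] : Type (max u v) :=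
  UniformSpace.Completion (g ⊗[ℂ] h)

variable {g : Type u} [NormedAddCommGroup g] [InnerProductSpace ℂ g] [CompleteSpace g]
variable {h : Type v} [NormedAddCommGroup h] [InnerProductSpace ℂ h] [CompleteSpace h]

/-- The product vector `x ⊗ y` in `g ⊗ h`. -/
def tmulVec (x : g) (y : h) : HTensor g h := ((x ⊗ₜ[ℂ] y : g ⊗[ℂ] h) : HTensor g h)

/-- The bounded operator `A ⊗ B` on `g ⊗ h`. -/
def opTensor (A : g →L[ℂ] g) (B : h →L[ℂ] h) : HTensor g h →L[ℂ] HTensor g h :=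
  (TensorProduct.mapL A B).completion

/-- `A = Tr_h Y`: the bounded operator `A` on `g` is the partial trace over `h` of the bounded
operator `Y` on `g ⊗ h`, i.e. `⟨x, A x'⟩ = ∑ₖ ⟨x ⊗ k, Y (x' ⊗ k)⟩` for all `x, x'`, the sum
running over an orthonormal basis of `h`. -/
def IsPartialTrace (Y : HTensor g h →L[ℂ] HTensor g h) (A : g →L[ℂ] g) : Prop :=
  ∀ x x' : g, HasSum
    (fun k => inner ℂ (tmulVec x (stdBasis h k)) (Y (tmulVec x' (stdBasis h k))))
    (inner ℂ x (A x'))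

/-- A quantum operation: a completely positive map `Φ : B(h) → B(g)` which is normal
(it preserves suprema of increasing nets in the operator order) and satisfies `Φ(1) ≤ 1`. -/
structure IsQuantumOperation (Φ : (h →L[ℂ] h) →CP (g →L[ℂ] g)) : Prop where
  normal : ScottContinuous Φ
  map_one_le : Φ 1 ≤ 1

/-- The norm of a completely positive map as a (bounded) linear map `B(h) → B(g)`. -/
def opNorm (Φ : (h →L[ℂ] h) →CP (g →L[ℂ] g)) : ℝ :=
  ‖(⟨Φ.toLinearMap, map_continuous Φ⟩ : (h →L[ℂ] h) →L[ℂ] (g →L[ℂ] g))‖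

/-- `Φτ` is the (bounded) operational density of `Φ`: a positive operator on `g ⊗ h` with
`Φ(B) = Tr_h [(1 ⊗ B~) Φτ]` for all bounded `B`. -/
structure IsOperationalDensity (C : Conjugation h) (Φ : (h →L[ℂ] h) →CP (g →L[ℂ] g))
    (Φτ : HTensor g h →L[ℂ] HTensor g h) : Prop where
  nonneg : 0 ≤ Φτ
  apply_eq : ∀ B : h →L[ℂ] h, IsPartialTrace (opTensor 1 (transpose C B) ∘L Φτ) (Φ B)

/-- The purifications of `Φτ`: bounded operators `Γ` on `g ⊗ h` with `Γ† Γ = Φτ`. -/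
abbrev Purification (Φτ : HTensor g h →L[ℂ] HTensor g h) :=
  {Γ : HTensor g h →L[ℂ] HTensor g h // ContinuousLinearMap.adjoint Γ ∘L Γ = Φτ}

/-- `c(A; ρ) = ½ Tr (A (ρ ⊗ 1) A†)`. -/
def cost (A : HTensor g h →L[ℂ] HTensor g h) (ρ : NormalState g) : ℝ :=
  (trace (A ∘L opTensor ρ.density 1 ∘L ContinuousLinearMap.adjoint A)).re / 2

/-- The squared Hellinger distance `½ inf ‖Tr_h (Γ - Υ)† (Γ - Υ)‖`, the infimum being over all
purifications `Γ` of `Φτ` and `Υ` of `Ψτ`. -/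
def hellingerSq (Φτ Ψτ : HTensor g h →L[ℂ] HTensor g h) : ℝ :=
  sInf {r : ℝ | ∃ (Γ : Purification Φτ) (Υ : Purification Ψτ) (D : g →L[ℂ] g),
    IsPartialTrace (ContinuousLinearMap.adjoint (Γ.1 - Υ.1) ∘L (Γ.1 - Υ.1)) D ∧ r = ‖D‖ / 2}

/-- The minimax form of the squared Hellinger distance: infimum over purifications of the
supremum over states of `c(Γ - Υ; ρ)`. -/
def hellingerSqMinimax (Φτ Ψτ : HTensor g h →L[ℂ] HTensor g h) : ℝ :=
  ⨅ p : Purification Φτ × Purification Ψτ, ⨆ ρ : NormalState g, cost (p.1.1 - p.2.1) ρ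

/-- The squared pointwise distance at the state `ρ`: infimum over purifications of
`c(Γ - Υ; ρ)`. -/
def hellingerSqAt (Φτ Ψτ : HTensor g h →L[ℂ] HTensor g h) (ρ : NormalState g) : ℝ :=
  ⨅ p : Purification Φτ × Purification Ψτ, cost (p.1.1 - p.2.1) ρ

/-- The minimax fidelity. The trace of `Φτ^{1/2} Υ (ρ ⊗ 1)` is written in the cyclically
rearranged form `Tr [Υ (ρ ⊗ 1) Φτ^{1/2}]`; the operator in this form is always trace class. -/
def minimaxFidelity (C : Conjugation g) (Φ Ψ : (h →L[ℂ] h) →CP (g →L[ℂ] g))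
    (Φτ Ψτ : HTensor g h →L[ℂ] HTensor g h) : ℝ :=
  ⨅ ρ : NormalState g, ⨆ Υ : Purification Ψτ,
    (trace (Υ.1 ∘L opTensor ρ.density 1 ∘L CFC.sqrt Φτ)).re /
      (√((ρ.eval C (Φ 1)).re) * √((ρ.eval C (Ψ 1)).re))

end Tensor

end QOp

end

/-! Pure states already determine a quadratic form, so constancy of the two expectations forces Φ(1)
= a·1 and Ψ(1) = b·1. Hence for every state and all purifications Γ, Υ the operators Γ(ρ ⊗ 1)^{1/2}
and Υ(ρ ⊗ 1)^{1/2} are Hilbert–Schmidt with squared norms a and b. Expanding the square gives c(Γ -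
Υ; ρ) = (a + b)/2 - Re Tr[Υ(ρ ⊗ 1)Γ†] (`Purification.cost_sub`), and everything reduces to
exchanging inf over ρ with sup over (Γ, Υ) in this overlap.

Purifications do not form a convex set, so the problem is relaxed. With Y, X the square roots of Φτ,
Ψτ, every purification is a contraction applied to Y or X, so each overlap equals Re Tr[W X(ρ ⊗ 1)Y]
for some W with ‖W‖ ≤ 1 not depending on ρ. This is affine in W and in ρ, and the unit ball is
compact in the weak operator topology; Sion's theorem yields one W good for all ρ
(`exists_contraction_forall_ge`).

The relaxation loses nothing (`Purification.exists_forall_overlap_ge`). If g ⊗ h is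
infinite-dimensional, W = J†V with isometries J, V, and (JY, VX) is a pair of purifications with the
same overlap (`exists_dilation`). In finite dimension isometries are unitary, so instead X, Y and ρ
are perturbed to be invertible: a saddle point then has a unitary W, and a limit removes the
perturbation (`exists_unitary_forall_trace_ge`).

Two identifications remain. The norm of Tr_h (Γ - Υ)†(Γ - Υ) is a supremum over states because this
partial trace is F†F for a bounded F, whose norm is tested on pure states. In the fidelity Γ is
frozen at Y; at a fixed state this does not change the supremum, because a real-linear functional
has the same supremum over unitaries as over the unit ball (`exists_unitary_ge_sub`). -/

noncomputable section

namespace QOp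

/-! ### Square-summable families, Cauchy–Schwarz and polarization. -/

section SquareSummable

variable {ι : Type*}

theorem summable_norm_mul_norm {E : Type*} [SeminormedAddCommGroup E] {f g : ι → E} (hf : Summable fun i => ‖f i‖ ^ 2)
    (hg : Summable fun i => ‖g i‖ ^ 2) : Summable fun i => ‖f i‖ * ‖g i‖ := by
  refine Summable.of_nonneg_of_le (fun i => by positivity) (fun i => ?_) (hf.add hg)
  nlinarith [sq_nonneg (‖f i‖ - ‖g i‖), sq_nonneg ‖f i‖, sq_nonneg ‖g i‖]

theorem summable_norm_sq_add {E : Type*} [SeminormedAddCommGroup E] {f g : ι → E} (hf : Summable fun i => ‖f i‖ ^ 2)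
    (hg : Summable fun i => ‖g i‖ ^ 2) : Summable fun i => ‖f i + g i‖ ^ 2 := by
  refine Summable.of_nonneg_of_le (fun i => by positivity) (fun i => ?_)
    ((hf.add hg).mul_left 2)
  have := norm_add_le (f i) (g i)
  nlinarith [sq_nonneg (‖f i‖ - ‖g i‖), norm_nonneg (f i + g i)]

variable {E : Type*} [NormedAddCommGroup E] [InnerProductSpace ℂ E]
variable {F : Type*} [NormedAddCommGroup F] [InnerProductSpace ℂ F]

theorem summable_inner_of_norm_sq {f g : ι → E} (hf : Summable fun i => ‖f i‖ ^ 2)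
    (hg : Summable fun i => ‖g i‖ ^ 2) : Summable fun i => inner ℂ (f i) (g i) := by
  refine Summable.of_norm_bounded (hf.add hg) fun i => ?_
  refine (norm_inner_le_norm _ _).trans ?_
  nlinarith [sq_nonneg (‖f i‖ - ‖g i‖), sq_nonneg ‖f i‖, sq_nonneg ‖g i‖]

theorem summable_norm_sq_comp_left (A : E →L[ℂ] F) {f : ι → E} (hf : Summable fun i => ‖f i‖ ^ 2) :
    Summable fun i => ‖A (f i)‖ ^ 2 := by
  refine Summable.of_nonneg_of_le (fun i => by positivity) (fun i => ?_) (hf.mul_left (‖A‖ ^ 2))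
  rw [← mul_pow]
  exact pow_le_pow_left₀ (norm_nonneg _) (A.le_opNorm _) 2

theorem norm_tsum_inner_le {f g : ι → E} (hf : Summable fun i => ‖f i‖ ^ 2)
    (hg : Summable fun i => ‖g i‖ ^ 2) :
    ‖∑' i, inner ℂ (f i) (g i)‖ ≤ √(∑' i, ‖f i‖ ^ 2) * √(∑' i, ‖g i‖ ^ 2) := by
  have h1 : Summable fun i => ‖inner ℂ (f i) (g i)‖ :=
    Summable.of_nonneg_of_le (fun i => norm_nonneg _) (fun i => norm_inner_le_norm _ _)
      (summable_norm_mul_norm hf hg)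
  refine (norm_tsum_le_tsum_norm h1).trans ?_
  refine (h1.tsum_le_tsum (fun i => norm_inner_le_norm _ _) (summable_norm_mul_norm hf hg)).trans ?_
  refine Real.tsum_le_of_sum_le (fun i => by positivity) fun s => ?_
  refine (Real.sum_mul_le_sqrt_mul_sqrt s _ _).trans ?_
  gcongr
  · exact hf.sum_le_tsum s fun i _ => by positivity
  · exact hg.sum_le_tsum s fun i _ => by positivity

/-- Every term has the form ‖x + z • y‖², so that one family of identities indexed by z can be
substituted four times. -/
theorem inner_eq_polarization (x y : E) : inner ℂ x y =
    (((‖x + (1 : ℂ) • y‖ ^ 2 : ℝ) : ℂ) - ((‖x + (-1 : ℂ) • y‖ ^ 2 : ℝ) : ℂ)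
      + (((‖x + (-Complex.I) • y‖ ^ 2 : ℝ) : ℂ) - ((‖x + Complex.I • y‖ ^ 2 : ℝ) : ℂ))
        * Complex.I) / 4 := by
  rw [inner_eq_sum_norm_sq_div_four x y]
  simp [sub_eq_add_neg]

theorem inner_swap_eq_polarization (x y : E) : inner ℂ y x =
    (((‖x + (1 : ℂ) • y‖ ^ 2 : ℝ) : ℂ) - ((‖x + (-1 : ℂ) • y‖ ^ 2 : ℝ) : ℂ)
      + (((‖x + Complex.I • y‖ ^ 2 : ℝ) : ℂ) - ((‖x + (-Complex.I) • y‖ ^ 2 : ℝ) : ℂ))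
        * Complex.I) / 4 := by
  rw [← inner_conj_symm, inner_eq_polarization x y]
  simp only [map_div₀, map_add, map_sub, map_mul, Complex.conj_ofReal, Complex.conj_I, map_ofNat]
  ring

theorem hasSum_norm_inner_sq (b : HilbertBasis ι ℂ E) (x : E) :
    HasSum (fun i => ‖inner ℂ (b i) x‖ ^ 2) (‖x‖ ^ 2) := by
  have h := (b.hasSum_inner_mul_inner x x).mapL Complex.reCLM
  simp only [Complex.reCLM_apply, inner_self_eq_norm_sq_to_K] at h
  convert h using 1
  · funext i
    rw [← inner_conj_symm x (b i), mul_comm, Complex.mul_conj, Complex.normSq_eq_norm_sq]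
    rw [Complex.ofReal_re]
  · norm_cast

end SquareSummable

/-! ### Basis independence of Hilbert–Schmidt sums. -/

section HilbertSchmidt

variable {E : Type*} [NormedAddCommGroup E] [InnerProductSpace ℂ E] [CompleteSpace E]
variable {F : Type*} [NormedAddCommGroup F] [InnerProductSpace ℂ F] [CompleteSpace F]
variable {ι κ : Type*}

/-- Tonelli for non-negative double series. -/
theorem hasSum_fiber_comm {f : ι → κ → ℝ} (hf : ∀ i j, 0 ≤ f i j) {r : ι → ℝ} {c : κ → ℝ} {s : ℝ}
    (hr : ∀ i, HasSum (f i) (r i)) (hc : ∀ j, HasSum (fun i => f i j) (c j)) (hs : HasSum r s) :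
    HasSum c s := by
  have hsum : Summable (fun p : ι × κ => f p.1 p.2) := by
    rw [summable_prod_of_nonneg (fun p => hf p.1 p.2)]
    refine ⟨fun i => (hr i).summable, ?_⟩
    simpa [fun i => (hr i).tsum_eq] using hs.summable
  obtain ⟨t, ht⟩ := hsum
  have h1 : HasSum r t := ht.prod_fiberwise hr
  have h2 : HasSum c t :=
    HasSum.prod_fiberwise (f := fun p : κ × ι => f p.2 p.1)
      ((Equiv.prodComm κ ι).hasSum_iff.mpr ht) hc
  rwa [hs.unique h1]

/-- Parseval in each variable turns both sides into the same double sum of |⟨c j, A b i⟩|². -/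
theorem hasSum_norm_sq_adjoint (b : HilbertBasis ι ℂ E) (c : HilbertBasis κ ℂ F) (A : E →L[ℂ] F)
    {s : ℝ} (hs : HasSum (fun i => ‖A (b i)‖ ^ 2) s) :
    HasSum (fun j => ‖ContinuousLinearMap.adjoint A (c j)‖ ^ 2) s := by
  refine hasSum_fiber_comm (f := fun i j => ‖inner ℂ (c j) (A (b i))‖ ^ 2)
    (fun _ _ => by positivity) (fun i => hasSum_norm_inner_sq c _) (fun j => ?_) hs
  convert hasSum_norm_inner_sq b (ContinuousLinearMap.adjoint A (c j)) using 3 with i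
  rw [ContinuousLinearMap.adjoint_inner_right, ← inner_conj_symm, RCLike.norm_conj]

/-- Polarization of the previous identity applied to A + zB. Taking adjoints conjugates z, which is
why A and B change places in the inner product. -/
theorem hasSum_inner_adjoint (b : HilbertBasis ι ℂ E) (c : HilbertBasis κ ℂ F) (A B : E →L[ℂ] F)
    (hA : Summable fun i => ‖A (b i)‖ ^ 2) (hB : Summable fun i => ‖B (b i)‖ ^ 2) :
    HasSum (fun j => inner ℂ (ContinuousLinearMap.adjoint A (c j))
      (ContinuousLinearMap.adjoint B (c j))) (∑' i, inner ℂ (B (b i)) (A (b i))) := by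
  have key : ∀ z : ℂ, HasSum (fun j => ‖ContinuousLinearMap.adjoint A (c j)
      + (starRingEnd ℂ z) • ContinuousLinearMap.adjoint B (c j)‖ ^ 2)
      (∑' i, ‖A (b i) + z • B (b i)‖ ^ 2) := by
    intro z
    have hs : Summable fun i => ‖A (b i) + z • B (b i)‖ ^ 2 := by
      refine summable_norm_sq_add hA ?_
      simp only [norm_smul, mul_pow]
      exact hB.mul_left _
    simpa [map_smulₛₗ] using hasSum_norm_sq_adjoint b c (A + z • B)
      (s := ∑' i, ‖A (b i) + z • B (b i)‖ ^ 2) (by simpa using hs.hasSum)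
  have key' : ∀ z : ℂ, HasSum (fun i => ‖A (b i) + z • B (b i)‖ ^ 2)
      (∑' i, ‖A (b i) + z • B (b i)‖ ^ 2) := by
    intro z
    refine Summable.hasSum (summable_norm_sq_add hA ?_)
    simp only [norm_smul, mul_pow]
    exact hB.mul_left _
  have c1 := fun z => (key z).mapL Complex.ofRealCLM
  have c2 := fun z => (key' z).mapL Complex.ofRealCLM
  simp only [Complex.ofRealCLM_apply] at c1 c2
  have s1 := ((((c1 1).sub (c1 (-1))).add (((c1 Complex.I).sub (c1 (-Complex.I))).mul_right Complex.I))).div_const 4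
  have s2 := ((((c2 1).sub (c2 (-1))).add (((c2 Complex.I).sub (c2 (-Complex.I))).mul_right Complex.I))).div_const 4
  simp only [← inner_swap_eq_polarization] at s2
  rw [← s2.tsum_eq] at s1
  simpa only [map_neg, map_one, Complex.conj_I, neg_neg, ← inner_eq_polarization] using s1

/-- For Hilbert–Schmidt `A`, `B`, the trace of `A B†` is the Hilbert–Schmidt inner product, computed
in any Hilbert basis. -/
theorem hasSum_trace_comp_adjoint (b : HilbertBasis ι ℂ E) (A B : E →L[ℂ] F)
    (hA : Summable fun i => ‖A (b i)‖ ^ 2) (hB : Summable fun i => ‖B (b i)‖ ^ 2) :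
    HasSum (fun j => inner ℂ (stdBasis F j) ((A ∘L ContinuousLinearMap.adjoint B) (stdBasis F j)))
      (∑' i, inner ℂ (B (b i)) (A (b i))) := by
  convert hasSum_inner_adjoint b (stdBasis F) A B hA hB using 2 with j
  rw [ContinuousLinearMap.adjoint_inner_left]
  rfl

theorem trace_comp_adjoint (b : HilbertBasis ι ℂ E) (A B : E →L[ℂ] F)
    (hA : Summable fun i => ‖A (b i)‖ ^ 2) (hB : Summable fun i => ‖B (b i)‖ ^ 2) :
    trace (A ∘L ContinuousLinearMap.adjoint B) = ∑' i, inner ℂ (B (b i)) (A (b i)) :=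
  (hasSum_trace_comp_adjoint b A B hA hB).tsum_eq

end HilbertSchmidt

/-! ### Product vectors, product operators and product bases. -/

section TensorOperators

variable {g : Type*} [NormedAddCommGroup g] [InnerProductSpace ℂ g]
variable {h : Type*} [NormedAddCommGroup h] [InnerProductSpace ℂ h]

@[simp]
theorem inner_tmulVec (x x' : g) (y y' : h) :
    inner ℂ (tmulVec x y) (tmulVec x' y') = inner ℂ x x' * inner ℂ y y' := by
  simp [tmulVec]

@[simp]
theorem norm_tmulVec (x : g) (y : h) : ‖tmulVec x y‖ = ‖x‖ * ‖y‖ := by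
  simp [tmulVec]

/-- The bounded operator `y ↦ x ⊗ y` from `h` to `g ⊗ h`. -/
def tmulRight (x : g) : h →L[ℂ] HTensor g h :=
  (UniformSpace.Completion.toComplL (𝕜 := ℂ) (E := g ⊗[ℂ] h)).comp (TensorProduct.mkL ℂ g h x)

/-- The bounded operator `x ↦ x ⊗ y` from `g` to `g ⊗ h`. -/
def tmulLeft (y : h) : g →L[ℂ] HTensor g h :=
  (UniformSpace.Completion.toComplL (𝕜 := ℂ) (E := g ⊗[ℂ] h)).comp
    ((TensorProduct.mkL ℂ g h).flip y)

@[simp]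
theorem tmulRight_apply (x : g) (y : h) : tmulRight x y = tmulVec x y := rfl

theorem dense_span_tmulVec :
    Dense (Submodule.span ℂ (Set.range fun p : g × h => tmulVec p.1 p.2) : Set (HTensor g h)) := by
  refine UniformSpace.Completion.denseRange_coe.mono ?_
  rintro _ ⟨t, rfl⟩
  induction t with
  | zero => exact Submodule.zero_mem _
  | tmul x y => exact Submodule.subset_span ⟨(x, y), rfl⟩
  | add s t hs ht =>
    rw [UniformSpace.Completion.coe_add]
    exact Submodule.add_mem _ hs ht

theorem clm_ext_tmulVec {G : Type*} [NormedAddCommGroup G] [NormedSpace ℂ G]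
    {S T : HTensor g h →L[ℂ] G} (H : ∀ x y, S (tmulVec x y) = T (tmulVec x y)) : S = T := by
  refine ContinuousLinearMap.ext_on dense_span_tmulVec ?_
  rintro _ ⟨p, rfl⟩
  exact H _ _

theorem inner_ext_tmulVec {v w : HTensor g h}
    (H : ∀ x y, inner ℂ (tmulVec x y) v = inner ℂ (tmulVec x y) w) : v = w := by
  refine ext_inner_left ℂ fun u => ?_
  have := clm_ext_tmulVec (S := innerSL ℂ v) (T := innerSL ℂ w) (fun x y => by
    simp only [innerSL_apply_apply]
    rw [← inner_conj_symm, H, inner_conj_symm])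
  have := DFunLike.congr_fun this u
  simp only [innerSL_apply_apply] at this
  rw [← inner_conj_symm, this, inner_conj_symm]

@[simp]
theorem opTensor_tmulVec (A : g →L[ℂ] g) (B : h →L[ℂ] h) (x : g) (y : h) :
    opTensor A B (tmulVec x y) = tmulVec (A x) (B y) := by
  simp only [opTensor, tmulVec]
  exact UniformSpace.Completion.map_coe (TensorProduct.mapL A B).uniformContinuous _

theorem opTensor_one_one : opTensor (1 : g →L[ℂ] g) (1 : h →L[ℂ] h) = 1 :=
  clm_ext_tmulVec fun x y => by simp

theorem opTensor_comp (A A' : g →L[ℂ] g) (B B' : h →L[ℂ] h) :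
    opTensor (A ∘L A') (B ∘L B') = opTensor A B ∘L opTensor A' B' :=
  clm_ext_tmulVec fun x y => by simp

theorem tmulVec_add_left (x x' : g) (y : h) :
    tmulVec (x + x') y = tmulVec x y + tmulVec x' y := map_add (tmulLeft y) x x'

theorem tmulVec_smul_left (c : ℂ) (x : g) (y : h) :
    tmulVec (c • x) y = c • tmulVec x y := map_smul (tmulLeft y) c x

theorem opTensor_add_left (A A' : g →L[ℂ] g) (B : h →L[ℂ] h) :
    opTensor (A + A') B = opTensor A B + opTensor A' B :=
  clm_ext_tmulVec fun x y => by simp [tmulVec_add_left]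

theorem opTensor_smul_left (c : ℂ) (A : g →L[ℂ] g) (B : h →L[ℂ] h) :
    opTensor (c • A) B = c • opTensor A B :=
  clm_ext_tmulVec fun x y => by simp [tmulVec_smul_left]

theorem adjoint_opTensor [CompleteSpace g] [CompleteSpace h] (A : g →L[ℂ] g) (B : h →L[ℂ] h) :
    ContinuousLinearMap.adjoint (opTensor A B)
      = opTensor (ContinuousLinearMap.adjoint A) (ContinuousLinearMap.adjoint B) := by
  refine clm_ext_tmulVec fun x y => inner_ext_tmulVec fun x' y' => ?_
  simp [ContinuousLinearMap.adjoint_inner_right]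

variable {ι κ : Type*}

/-- The product of two Hilbert bases is a Hilbert basis of the Hilbert space tensor product. -/
def tensorBasis (b : HilbertBasis ι ℂ g) (c : HilbertBasis κ ℂ h) :
    HilbertBasis (ι × κ) ℂ (HTensor g h) :=
  HilbertBasis.mk (v := fun p : ι × κ => tmulVec (b p.1) (c p.2))
    (by
      have := b.orthonormal.tmul c.orthonormal
      classical
      rw [orthonormal_iff_ite] at this ⊢
      intro p q
      simpa [tmulVec] using this p q)
    (by
      -- Totality is obtained one factor at a time: continuity in the second factor gives all b i ⊗
      -- y, then continuity in the first gives all x ⊗ y.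
      set S := (Submodule.span ℂ
        (Set.range fun p : ι × κ => tmulVec (b p.1) (c p.2))).topologicalClosure
      have h1 : ∀ i y, tmulVec (b i) y ∈ S := by
        intro i y
        have hy : y ∈ closure (Submodule.span ℂ (Set.range c) : Set h) := by
          have := c.dense_span
          rw [← Submodule.topologicalClosure_coe, this]; trivial
        have := map_mem_closure (f := tmulRight (b i)) (t := (S : Set (HTensor g h)))
          (tmulRight (b i)).continuous hy (fun z hz => by
            have : Submodule.span ℂ (Set.range c) ≤ S.comap (tmulRight (b i)).toLinearMap := by
              rw [Submodule.span_le]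
              rintro _ ⟨k, rfl⟩
              exact Submodule.le_topologicalClosure _ (Submodule.subset_span ⟨(i, k), rfl⟩)
            exact this hz)
        rwa [(Submodule.isClosed_topologicalClosure _).closure_eq] at this
      have h2 : ∀ x y, tmulVec x y ∈ S := by
        intro x y
        have hx : x ∈ closure (Submodule.span ℂ (Set.range b) : Set g) := by
          have := b.dense_span
          rw [← Submodule.topologicalClosure_coe, this]; trivial
        have := map_mem_closure (f := tmulLeft y) (t := (S : Set (HTensor g h)))
          (tmulLeft y).continuous hx (fun z hz => by
            have : Submodule.span ℂ (Set.range b) ≤ S.comap (tmulLeft y).toLinearMap := by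
              rw [Submodule.span_le]
              rintro _ ⟨i, rfl⟩
              exact h1 i y
            exact this hz)
        rwa [(Submodule.isClosed_topologicalClosure _).closure_eq] at this
      have h3 : Submodule.span ℂ (Set.range fun p : g × h => tmulVec p.1 p.2) ≤ S := by
        rw [Submodule.span_le]
        rintro _ ⟨p, rfl⟩
        exact h2 _ _
      have h4 := (Submodule.dense_iff_topologicalClosure_eq_top.mp
        (dense_span_tmulVec (g := g) (h := h)))
      rw [← h4]
      exact Submodule.topologicalClosure_minimal _ h3
        (Submodule.isClosed_topologicalClosure _))

@[simp]
theorem tensorBasis_apply (b : HilbertBasis ι ℂ g) (c : HilbertBasis κ ℂ h) (p : ι × κ) :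
    tensorBasis b c p = tmulVec (b p.1) (c p.2) := by
  simp [tensorBasis]

end TensorOperators

/-! ### Partial traces of Z†Z as F†F. -/

section Fibre

variable {g : Type*} [NormedAddCommGroup g] [InnerProductSpace ℂ g]
variable {h : Type*} [NormedAddCommGroup h] [InnerProductSpace ℂ h] [CompleteSpace h]
variable {H : Type*} [NormedAddCommGroup H] [InnerProductSpace ℂ H]

variable (h H) in
/-- The Hilbert space of square summable families in `H`, indexed by the fixed basis of `h`. -/
abbrev FibreSpace := lp (fun _ : (exists_hilbertBasis ℂ h).choose => H) 2

/-- `F` sends `x` to the square summable family `(Z (x ⊗ k))ₖ`; then `F† F` is the partial trace of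
`Z† Z`. -/
def IsFibre (Z : HTensor g h →L[ℂ] H) (F : g →L[ℂ] FibreSpace h H) : Prop :=
  ∀ x k, F x k = Z (tmulVec x (stdBasis h k))

theorem exists_isFibre (Z : HTensor g h →L[ℂ] H) (C : ℝ)
    (hZ : ∀ x (s : Finset _), ∑ k ∈ s, ‖Z (tmulVec x (stdBasis h k))‖ ^ 2 ≤ (C * ‖x‖) ^ 2) :
    ∃ F : g →L[ℂ] FibreSpace h H, IsFibre Z F := by
  have hmem : ∀ x, Memℓp (fun k => Z (tmulVec x (stdBasis h k))) 2 := by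
    intro x
    refine memℓp_gen' (C := (C * ‖x‖) ^ 2) fun s => ?_
    simpa using hZ x s
  let L : g →ₗ[ℂ] FibreSpace h H :=
    { toFun := fun x => ⟨_, hmem x⟩
      map_add' := fun x y => by
        ext k
        simp only [tmulVec_add_left, map_add]
        rfl
      map_smul' := fun c x => by
        ext k
        simp only [tmulVec_smul_left, map_smul]
        rfl }
  -- The hypothesis only sees C², so C may be negative; the operator bound needs |C|.
  refine ⟨L.mkContinuous |C| fun x => ?_, fun x k => rfl⟩
  refine lp.norm_le_of_forall_sum_le (by norm_num) (by positivity) fun s => ?_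
  have := hZ x s
  rw [mul_pow, ← sq_abs C, ← mul_pow] at this
  rw [ENNReal.toReal_ofNat, Real.rpow_two]
  refine le_trans (le_of_eq ?_) this
  exact Finset.sum_congr rfl fun k _ => Real.rpow_two _

variable {Z Z' : HTensor g h →L[ℂ] H} {F F' : g →L[ℂ] FibreSpace h H}

theorem IsFibre.sub (hF : IsFibre Z F) (hF' : IsFibre Z' F') : IsFibre (Z - Z') (F - F') := by
  intro x k
  simp [hF x k, hF' x k]

theorem IsFibre.hasSum_inner (hF : IsFibre Z F) (hF' : IsFibre Z' F') (x x' : g) :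
    HasSum (fun k => inner ℂ (Z (tmulVec x (stdBasis h k))) (Z' (tmulVec x' (stdBasis h k))))
      (inner ℂ (F x) (F' x')) := by
  simpa only [hF x, hF' x'] using lp.hasSum_inner (F x) (F' x')

theorem IsFibre.hasSum_norm_sq (hF : IsFibre Z F) (x : g) :
    HasSum (fun k => ‖Z (tmulVec x (stdBasis h k))‖ ^ 2) (‖F x‖ ^ 2) := by
  have := (hF.hasSum_inner hF x x).mapL Complex.reCLM
  simpa [inner_self_eq_norm_sq_to_K, ← Complex.ofReal_pow] using this

theorem IsFibre.exists_comp {K : Type*} [NormedAddCommGroup K] [InnerProductSpace ℂ K]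
    (hF : IsFibre Z F) (W : H →L[ℂ] K) : ∃ G : g →L[ℂ] FibreSpace h K, IsFibre (W ∘L Z) G := by
  refine exists_isFibre _ (‖W‖ * ‖F‖) fun x s => ?_
  calc ∑ k ∈ s, ‖W (Z (tmulVec x (stdBasis h k)))‖ ^ 2
      ≤ ∑ k ∈ s, ‖W‖ ^ 2 * ‖Z (tmulVec x (stdBasis h k))‖ ^ 2 := by
        refine Finset.sum_le_sum fun k _ => ?_
        rw [← mul_pow]
        exact pow_le_pow_left₀ (norm_nonneg _) (W.le_opNorm _) 2
    _ ≤ ‖W‖ ^ 2 * ‖F x‖ ^ 2 := by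
        rw [← Finset.mul_sum]
        gcongr
        exact sum_le_hasSum s (fun _ _ => by positivity) (hF.hasSum_norm_sq x)
    _ ≤ (‖W‖ * ‖F‖ * ‖x‖) ^ 2 := by
        rw [← mul_pow, mul_assoc]
        gcongr
        exact F.le_opNorm x

/-- Hilbert–Schmidt sums of `Z (R ⊗ 1)` reduce to sums over a basis of `g`. -/
theorem IsFibre.hasSum_norm_sq_basis {ι : Type*} (hF : IsFibre Z F) (b : HilbertBasis ι ℂ g)
    (R : g →L[ℂ] g) (hR : Summable fun i => ‖R (b i)‖ ^ 2) :
    HasSum (fun p => ‖(Z ∘L opTensor R 1) (tensorBasis b (stdBasis h) p)‖ ^ 2)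
      (∑' i, ‖F (R (b i))‖ ^ 2) := by
  have h1 : ∀ i, HasSum
      (fun k => ‖(Z ∘L opTensor R 1) (tensorBasis b (stdBasis h) (i, k))‖ ^ 2)
      (‖F (R (b i))‖ ^ 2) := fun i => by simpa using hF.hasSum_norm_sq (R (b i))
  have h2 : Summable fun p => ‖(Z ∘L opTensor R 1) (tensorBasis b (stdBasis h) p)‖ ^ 2 := by
    rw [summable_prod_of_nonneg (fun p => by positivity)]
    refine ⟨fun i => (h1 i).summable, ?_⟩
    simp only [fun i => (h1 i).tsum_eq]
    exact summable_norm_sq_comp_left F hR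
  have h3 := h2.hasSum.prod_fiberwise h1
  rw [h3.tsum_eq]
  exact h2.hasSum

end Fibre

/-! ### Normal states, their amplitudes and their values on operators. -/

section States

variable {g : Type*} [NormedAddCommGroup g] [InnerProductSpace ℂ g] [CompleteSpace g]

theorem adjoint_sqrt (A : g →L[ℂ] g) : ContinuousLinearMap.adjoint (CFC.sqrt A) = CFC.sqrt A :=
  (CFC.sqrt_nonneg A).isSelfAdjoint

theorem sqrt_comp_sqrt {A : g →L[ℂ] g} (hA : 0 ≤ A) : CFC.sqrt A ∘L CFC.sqrt A = A :=
  CFC.sqrt_mul_sqrt_self A hA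

theorem inner_self_apply_eq_norm_sq {A : g →L[ℂ] g} {T : g →L[ℂ] g}
    (hT : ContinuousLinearMap.adjoint T ∘L T = A) (x : g) :
    inner ℂ x (A x) = ((‖T x‖ ^ 2 : ℝ) : ℂ) := by
  rw [← hT, ContinuousLinearMap.comp_apply, ContinuousLinearMap.adjoint_inner_right,
    inner_self_eq_norm_sq_to_K]
  norm_cast

/-- A positive operator whose trace sum converges to `1` is the density of a normal state. -/
def NormalState.ofHasSum (D : g →L[ℂ] g) (h0 : 0 ≤ D)
    (hs : HasSum (fun i => inner ℂ (stdBasis g i) (D (stdBasis g i))) 1) : NormalState g where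
  density := D
  nonneg := h0
  traceClass := by
    rw [IsTraceClass, CFC.abs_of_nonneg D h0]
    exact hs.summable
  trace_eq_one := hs.tsum_eq

/-- The square root of the density operator of a state. -/
def NormalState.amplitude (ρ : NormalState g) : g →L[ℂ] g := CFC.sqrt ρ.density

theorem NormalState.adjoint_amplitude (ρ : NormalState g) :
    ContinuousLinearMap.adjoint ρ.amplitude = ρ.amplitude := adjoint_sqrt _

theorem NormalState.amplitude_comp_amplitude (ρ : NormalState g) :
    ρ.amplitude ∘L ρ.amplitude = ρ.density := sqrt_comp_sqrt ρ.nonneg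

theorem NormalState.hasSum_inner_density (ρ : NormalState g) :
    HasSum (fun i => inner ℂ (stdBasis g i) (ρ.density (stdBasis g i))) 1 := by
  have h := ρ.traceClass
  rw [IsTraceClass, CFC.abs_of_nonneg _ ρ.nonneg] at h
  rw [← ρ.trace_eq_one]
  exact h.hasSum

theorem NormalState.hasSum_norm_sq_amplitude (ρ : NormalState g) :
    HasSum (fun i => ‖ρ.amplitude (stdBasis g i)‖ ^ 2) 1 := by
  have h := ρ.hasSum_inner_density.mapL Complex.reCLM
  have e := inner_self_apply_eq_norm_sq (A := ρ.density) (T := ρ.amplitude)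
    (by rw [ρ.adjoint_amplitude, ρ.amplitude_comp_amplitude])
  simpa only [e, Complex.reCLM_apply, Complex.ofReal_re, Complex.one_re] using h

/-- The convex combination of two states. -/
def NormalState.mix (ρ σ : NormalState g) (s t : ℝ) (hs : 0 ≤ s) (ht : 0 ≤ t) (hst : s + t = 1) :
    NormalState g :=
  NormalState.ofHasSum ((s : ℂ) • ρ.density + (t : ℂ) • σ.density)
    (by
      have h1 : 0 ≤ s • ρ.density := smul_nonneg hs ρ.nonneg
      have h2 : 0 ≤ t • σ.density := smul_nonneg ht σ.nonneg
      simpa only [Complex.coe_smul] using add_nonneg h1 h2)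
    (by
      have := (ρ.hasSum_inner_density.mul_left (s : ℂ)).add
        (σ.hasSum_inner_density.mul_left (t : ℂ))
      have e : (s : ℂ) * 1 + (t : ℂ) * 1 = 1 := by rw [mul_one, mul_one, ← Complex.ofReal_add, hst]; simp
      rw [e] at this
      simpa [inner_add_right, inner_smul_right] using this)

/-- The pure state of a unit vector. -/
def NormalState.pure (x : g) (hx : ‖x‖ = 1) : NormalState g :=
  NormalState.ofHasSum (InnerProductSpace.rankOne ℂ x x)
    (by
      rw [ContinuousLinearMap.nonneg_iff_isPositive]
      exact InnerProductSpace.isPositive_rankOne_self x)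
    (by
      have := (stdBasis g).hasSum_inner_mul_inner x x
      rw [inner_self_eq_norm_sq_to_K, hx] at this
      simpa [inner_smul_right] using this)

theorem NormalState.amplitude_pure (x : g) (hx : ‖x‖ = 1) :
    (NormalState.pure x hx).amplitude = InnerProductSpace.rankOne ℂ x x := by
  have h0 : (0 : g →L[ℂ] g) ≤ InnerProductSpace.rankOne ℂ x x := (NormalState.pure x hx).nonneg
  refine CFC.sqrt_unique ?_ h0
  ext v
  simp [NormalState.pure, NormalState.ofHasSum, inner_self_eq_norm_sq_to_K, hx]

instance [Nontrivial g] : Nonempty (NormalState g) := by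
  obtain ⟨x, hx⟩ := exists_norm_eq g zero_le_one
  exact ⟨NormalState.pure x hx⟩

omit [CompleteSpace g] in
theorem Conjugation.inner_J_J (C : Conjugation g) (x y : g) :
    inner ℂ (C.J x) (C.J y) = inner ℂ y x := by
  have key : ∀ z : ℂ, ‖C.J x + z • C.J y‖ = ‖x + (starRingEnd ℂ z) • y‖ := by
    intro z
    rw [← C.J.norm_map (x + (starRingEnd ℂ z) • y), map_add, map_smulₛₗ]
    simp
  rw [inner_eq_polarization, inner_swap_eq_polarization]
  simp only [key, map_one, map_neg, Complex.conj_I, neg_neg]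

theorem transpose_apply (C : Conjugation g) (B : g →L[ℂ] g) (x : g) :
    transpose C B x = C.J (ContinuousLinearMap.adjoint B (C.J x)) := rfl

theorem transpose_one (C : Conjugation g) : transpose C (1 : g →L[ℂ] g) = 1 := by
  ext x
  rw [transpose_apply, ← ContinuousLinearMap.star_eq_adjoint, star_one]
  exact C.J_J x

theorem norm_transpose_le (C : Conjugation g) (B : g →L[ℂ] g) : ‖transpose C B‖ ≤ ‖B‖ := by
  refine ContinuousLinearMap.opNorm_le_bound _ (norm_nonneg _) fun x => ?_
  rw [transpose_apply, C.J.norm_map, ← C.J.norm_map x]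
  refine (ContinuousLinearMap.le_opNorm _ _).trans_eq ?_
  rw [← ContinuousLinearMap.star_eq_adjoint, norm_star]

theorem NormalState.eval_pure (C : Conjugation g) (x : g) (hx : ‖x‖ = 1) (A : g →L[ℂ] g) :
    (NormalState.pure x hx).eval C A = inner ℂ (C.J x) (A (C.J x)) := by
  have h1 : transpose C (NormalState.pure x hx).density
      = InnerProductSpace.rankOne ℂ (C.J x) (C.J x) := by
    ext v
    rw [transpose_apply]
    simp only [NormalState.pure, NormalState.ofHasSum, InnerProductSpace.adjoint_rankOne,
      InnerProductSpace.rankOne_apply, map_smulₛₗ]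
    rw [inner_conj_symm, ← C.inner_J_J, C.J_J]
  rw [NormalState.eval, h1, trace]
  rw [← ((stdBasis g).hasSum_inner_mul_inner (C.J x) (A (C.J x))).tsum_eq]
  simp

/-- The pure state of J y evaluates A to ⟨y, A y⟩, so the quadratic form of A is constant on the
unit sphere; over ℂ the quadratic form determines the operator. -/
theorem exists_eq_smul_one_of_eval_const [Nontrivial g] (C : Conjugation g) {A : g →L[ℂ] g}
    (hA : 0 ≤ A) (hc : ∀ ρ ρ' : NormalState g, ρ.eval C A = ρ'.eval C A) :
    ∃ a : ℝ, 0 ≤ a ∧ A = (a : ℂ) • (1 : g →L[ℂ] g) ∧ ∀ ρ : NormalState g, ρ.eval C A = a := by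
  obtain ⟨x₀, hx₀⟩ := exists_norm_eq g zero_le_one
  have hpos := (ContinuousLinearMap.nonneg_iff_isPositive A).mp hA
  have h0 : 0 ≤ inner ℂ (C.J x₀) (A (C.J x₀)) := by
    have := hpos.inner_nonneg_right (C.J x₀)
    exact this
  obtain ⟨a, ha⟩ : ∃ a : ℝ, (a : ℂ) = (NormalState.pure x₀ hx₀).eval C A := by
    rw [NormalState.eval_pure]
    exact ⟨_, (Complex.eq_re_of_ofReal_le h0).symm⟩
  have ha0 : 0 ≤ a := by
    rw [NormalState.eval_pure] at ha
    rw [← ha] at h0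
    exact_mod_cast h0
  have hall : ∀ ρ : NormalState g, ρ.eval C A = a := fun ρ => by rw [ha]; exact hc _ _
  refine ⟨a, ha0, ?_, hall⟩
  have hunit : ∀ y : g, ‖y‖ = 1 → inner ℂ y (A y) = a := by
    intro y hy
    have := hall (NormalState.pure (C.J y) (by rw [C.J.norm_map, hy]))
    rwa [NormalState.eval_pure, C.J_J] at this
  refine ContinuousLinearMap.coe_inj.mp ((ext_inner_map _ _).mp fun y => ?_)
  rw [ContinuousLinearMap.coe_coe, ContinuousLinearMap.coe_coe, ← inner_conj_symm,
    ← inner_conj_symm _ y]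
  congr 1
  by_cases hy : y = 0
  · simp [hy]
  have hn : (‖y‖ : ℂ) ≠ 0 := by simpa using hy
  have := hunit ((‖y‖⁻¹ : ℂ) • y) (by simp [norm_smul, hy])
  simp only [inner_smul_left, inner_smul_right, map_smul, smul_apply,
    one_apply_eq_self, inner_self_eq_norm_sq_to_K, map_inv₀, Complex.conj_ofReal] at this ⊢
  field_simp at this
  rw [this]
  simp [mul_comm]

end States

/-! ### Weighted traces and the cost function. -/

section WeightedTrace

theorem IsPartialTrace.unique {g : Type*} [NormedAddCommGroup g] [InnerProductSpace ℂ g]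
    {h : Type*} [NormedAddCommGroup h] [InnerProductSpace ℂ h] [CompleteSpace h]
    {Y : HTensor g h →L[ℂ] HTensor g h} {A B : g →L[ℂ] g}
    (hA : IsPartialTrace Y A) (hB : IsPartialTrace Y B) : A = B := by
  ext x'
  exact ext_inner_left ℂ fun x => (hA x x').unique (hB x x')

variable {g : Type*} [NormedAddCommGroup g] [InnerProductSpace ℂ g] [CompleteSpace g]
variable {h : Type*} [NormedAddCommGroup h] [InnerProductSpace ℂ h] [CompleteSpace h]
variable {Z Z' : HTensor g h →L[ℂ] HTensor g h} {F F' : g →L[ℂ] FibreSpace h (HTensor g h)}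

variable (g h) in
/-- The product of the fixed bases of `g` and `h`. -/
def prodBasis := tensorBasis (stdBasis g) (stdBasis h)

theorem IsFibre.hasSum_norm_sq_state (hF : IsFibre Z F) (ρ : NormalState g) :
    HasSum (fun p => ‖Z (opTensor ρ.amplitude 1 (prodBasis g h p))‖ ^ 2)
      (∑' i, ‖F (ρ.amplitude (stdBasis g i))‖ ^ 2) :=
  hF.hasSum_norm_sq_basis (stdBasis g) ρ.amplitude ρ.hasSum_norm_sq_amplitude.summable

/-- Splitting ρ into two amplitudes exhibits the operator as A B†; when both factors are
Hilbert–Schmidt, its trace can be computed in the product basis. -/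
theorem sandwich_eq (Z Z' : HTensor g h →L[ℂ] HTensor g h) (ρ : NormalState g) :
    Z' ∘L opTensor ρ.density 1 ∘L ContinuousLinearMap.adjoint Z
      = (Z' ∘L opTensor ρ.amplitude 1)
        ∘L ContinuousLinearMap.adjoint (Z ∘L opTensor ρ.amplitude 1) := by
  rw [ContinuousLinearMap.adjoint_comp, adjoint_opTensor, ρ.adjoint_amplitude,
    ← ContinuousLinearMap.star_eq_adjoint 1, star_one, ContinuousLinearMap.comp_assoc,
    ← ContinuousLinearMap.comp_assoc (opTensor ρ.amplitude 1), ← opTensor_comp,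
    ρ.amplitude_comp_amplitude]
  rfl

theorem IsFibre.hasSum_trace (hF : IsFibre Z F) (hF' : IsFibre Z' F') (ρ : NormalState g) :
    HasSum (fun j => inner ℂ (stdBasis (HTensor g h) j)
      ((Z' ∘L opTensor ρ.density 1 ∘L ContinuousLinearMap.adjoint Z)
        (stdBasis (HTensor g h) j)))
      (∑' p, inner ℂ (Z (opTensor ρ.amplitude 1 (prodBasis g h p)))
        (Z' (opTensor ρ.amplitude 1 (prodBasis g h p)))) := by
  rw [sandwich_eq]
  exact hasSum_trace_comp_adjoint (prodBasis g h) _ _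
    (hF'.hasSum_norm_sq_state ρ).summable (hF.hasSum_norm_sq_state ρ).summable

theorem IsFibre.trace_eq (hF : IsFibre Z F) (hF' : IsFibre Z' F') (ρ : NormalState g) :
    trace (Z' ∘L opTensor ρ.density 1 ∘L ContinuousLinearMap.adjoint Z)
      = ∑' p, inner ℂ (Z (opTensor ρ.amplitude 1 (prodBasis g h p)))
        (Z' (opTensor ρ.amplitude 1 (prodBasis g h p))) :=
  (hF.hasSum_trace hF' ρ).tsum_eq

theorem IsFibre.cost_eq (hF : IsFibre Z F) (ρ : NormalState g) :
    cost Z ρ = (∑' i, ‖F (ρ.amplitude (stdBasis g i))‖ ^ 2) / 2 := by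
  rw [cost, hF.trace_eq hF ρ, ← (hF.hasSum_norm_sq_state ρ).tsum_eq]
  simp only [inner_self_eq_norm_sq_to_K]
  norm_cast

theorem IsFibre.cost_le (hF : IsFibre Z F) (ρ : NormalState g) : cost Z ρ ≤ ‖F‖ ^ 2 / 2 := by
  rw [hF.cost_eq]
  gcongr
  have h1 := ρ.hasSum_norm_sq_amplitude
  have h2 := summable_norm_sq_comp_left F h1.summable
  have h3 := h1.mul_left (‖F‖ ^ 2)
  rw [mul_one] at h3
  refine hasSum_le (fun i => ?_) h2.hasSum h3
  rw [← mul_pow]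
  exact pow_le_pow_left₀ (norm_nonneg _) (F.le_opNorm _) 2

theorem IsFibre.cost_pure (hF : IsFibre Z F) (x : g) (hx : ‖x‖ = 1) :
    cost Z (NormalState.pure x hx) = ‖F x‖ ^ 2 / 2 := by
  rw [hF.cost_eq, NormalState.amplitude_pure]
  simp only [InnerProductSpace.rankOne_apply, map_smul, norm_smul, mul_pow]
  rw [tsum_mul_right]
  have := hasSum_norm_inner_sq (stdBasis g) x
  simp only [norm_inner_symm] at this ⊢
  have e : ∀ i, ‖inner ℂ x (stdBasis g i)‖ = ‖inner ℂ (stdBasis g i) x‖ := fun i => by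
    rw [← inner_conj_symm, RCLike.norm_conj]
  simp only [e]
  rw [(hasSum_norm_inner_sq (stdBasis g) x).tsum_eq, hx]
  simp

/-- Tr ρ = 1 bounds every cost by ‖F‖²/2, and the pure state of x has cost ‖F x‖²/2, so unit vectors
already recover the operator norm. -/
theorem IsFibre.iSup_cost [Nontrivial g] (hF : IsFibre Z F) :
    ⨆ ρ : NormalState g, cost Z ρ = ‖F‖ ^ 2 / 2 := by
  have hbdd : BddAbove (Set.range fun ρ : NormalState g => cost Z ρ) :=
    ⟨_, by rintro _ ⟨ρ, rfl⟩; exact hF.cost_le ρ⟩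
  refine le_antisymm (ciSup_le hF.cost_le) ?_
  set c := ⨆ ρ : NormalState g, cost Z ρ
  have hc : ∀ x, ‖x‖ = 1 → ‖F x‖ ^ 2 / 2 ≤ c := fun x hx => by
    rw [← hF.cost_pure x hx]
    exact le_ciSup hbdd _
  have hc0 : 0 ≤ c := by
    obtain ⟨x, hx⟩ := exists_norm_eq g zero_le_one
    exact le_trans (by positivity) (hc x hx)
  have : ‖F‖ ≤ √(2 * c) := by
    refine ContinuousLinearMap.opNorm_le_of_unit_norm (Real.sqrt_nonneg _) fun x hx => ?_
    refine Real.le_sqrt_of_sq_le ?_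
    linarith [hc x hx]
  have h2 := pow_le_pow_left₀ (norm_nonneg F) this 2
  rw [Real.sq_sqrt (by positivity)] at h2
  linarith

theorem IsFibre.isPartialTrace (hF : IsFibre Z F) :
    IsPartialTrace (ContinuousLinearMap.adjoint Z ∘L Z) (ContinuousLinearMap.adjoint F ∘L F) := by
  intro x x'
  simpa [ContinuousLinearMap.adjoint_inner_right] using hF.hasSum_inner hF x x'

theorem IsFibre.norm_eq_of_isPartialTrace [Nontrivial g] (hF : IsFibre Z F) {D : g →L[ℂ] g}
    (hD : IsPartialTrace (ContinuousLinearMap.adjoint Z ∘L Z) D) :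
    ‖D‖ / 2 = ⨆ ρ : NormalState g, cost Z ρ := by
  rw [hF.iSup_cost, hD.unique hF.isPartialTrace, ContinuousLinearMap.norm_adjoint_comp_self, sq]

end WeightedTrace

/-! ### Unitaries and the unit ball of a C*-algebra. -/

section CStar

variable {A : Type*} [CStarAlgebra A] [PartialOrder A] [StarOrderedRing A]

theorem exists_unitary_polar {T : A} (hT : IsUnit T) :
    ∃ V ∈ unitary A, T = V * CFC.abs T ∧ IsUnit (CFC.abs T) := by
  have h2 : CFC.abs T * CFC.abs T = star T * T := CFC.abs_mul_abs T
  have hu : IsUnit (CFC.abs T) := by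
    have : IsUnit (CFC.abs T * CFC.abs T) := by rw [h2]; exact hT.star.mul hT
    exact ((Commute.refl (CFC.abs T)).isUnit_mul_iff.mp this).1
  obtain ⟨B, hB⟩ := hu
  have hsa : star (B : A) = B := by rw [hB]; exact (CFC.abs_nonneg T).isSelfAdjoint
  have hsi : star ((B⁻¹ : Aˣ) : A) = (B⁻¹ : Aˣ) := by
    have h1 : star B = B := Units.ext hsa
    rw [← Units.coe_star, star_inv, h1]
  refine ⟨T * (B⁻¹ : Aˣ), ?_, ?_, hB ▸ B.isUnit⟩
  · have h3 : star (T * (B⁻¹ : Aˣ)) * (T * (B⁻¹ : Aˣ)) = 1 := by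
      rw [star_mul, hsi]
      calc _ = ((B⁻¹ : Aˣ) : A) * (star T * T) * (B⁻¹ : Aˣ) := by noncomm_ring
        _ = 1 := by rw [← h2, ← hB, ← mul_assoc, Units.inv_mul, one_mul, Units.mul_inv]
    have h4 : IsUnit (T * (B⁻¹ : Aˣ)) := hT.mul (B⁻¹).isUnit
    refine Unitary.mem_iff.mpr ⟨h3, ?_⟩
    obtain ⟨C, hC⟩ := h4
    rw [← hC] at h3 ⊢
    rw [← Units.inv_eq_of_mul_eq_one_left h3, Units.mul_inv]
  · rw [← hB, mul_assoc, Units.inv_mul, mul_one]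

/-- Gardner's lemma: `U + S` is a sum of two unitaries if `U` is unitary and `‖S‖ < 1`. -/
theorem exists_unitary_add_eq {U S : A} (hU : U ∈ unitary A) (hS : ‖S‖ < 1) :
    ∃ U₁ ∈ unitary A, ∃ U₂ ∈ unitary A, U + S = U₁ + U₂ := by
  have hn : ‖star U * S‖ < 1 := by
    have : ‖star U * S‖ = ‖S‖ := CStarRing.norm_mem_unitary_mul S (Unitary.star_mem hU)
    rwa [this]
  have hT : IsUnit (1 + star U * S) := by
    have := (Units.oneSub (-(star U * S)) (by rwa [norm_neg])).isUnit
    simpa using this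
  obtain ⟨V, hV, hpol, -⟩ := exists_unitary_polar hT
  set T := 1 + star U * S with hTdef
  have hTn : ‖CFC.abs T‖ ≤ 2 := by
    rw [CFC.norm_abs]
    by_cases hA : Nontrivial A
    · refine (norm_add_le _ _).trans ?_
      rw [norm_one]; linarith
    · rw [not_nontrivial_iff_subsingleton] at hA
      rw [Subsingleton.elim T 0, norm_zero]; norm_num
  -- Since ‖|T|‖ ≤ 2, a = |T|/2 is a self-adjoint contraction, and |T| is the sum of the unitaries a
  -- ± i(1 - a²)^{1/2}.
  set a : selfAdjoint A := ⟨(2⁻¹ : ℝ) • CFC.abs T,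
    IsSelfAdjoint.smul (IsSelfAdjoint.all (2⁻¹ : ℝ)) (CFC.abs_nonneg T).isSelfAdjoint⟩
  have han : ‖a‖ ≤ 1 := by
    change ‖(2⁻¹ : ℝ) • CFC.abs T‖ ≤ 1
    rw [norm_smul, Real.norm_of_nonneg (by norm_num)]
    linarith
  set Z := selfAdjoint.unitarySelfAddISMul a han
  have hZ : (Z : A) + star (Z : A) = CFC.abs T := by
    rw [selfAdjoint.star_coe_unitarySelfAddISMul,
      selfAdjoint.unitarySelfAddISMul_coe, add_add_sub_cancel]
    change (2⁻¹ : ℝ) • CFC.abs T + (2⁻¹ : ℝ) • CFC.abs T = _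
    rw [← add_smul]; norm_num
  refine ⟨U * V * Z, mul_mem (mul_mem hU hV) Z.2, U * V * star (Z : A),
    mul_mem (mul_mem hU hV) (Unitary.star_mem Z.2), ?_⟩
  rw [← mul_add, hZ, mul_assoc, ← hpol, hTdef, mul_add, mul_one, ← mul_assoc,
    Unitary.mul_star_self_of_mem hU, one_mul]

/-- A real-linear functional has the same supremum over the unitaries as over the unit ball. -/
theorem exists_unitary_ge_sub (l : A →ₗ[ℝ] ℝ) (C : ℝ) (hl : ∀ U ∈ unitary A, l U ≤ C)
    {W : A} (hW : ‖W‖ ≤ 1) {ε : ℝ} (hε : 0 < ε) : ∃ U ∈ unitary A, l W - ε ≤ l U := by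
  by_contra! hcon
  set β := sSup (l '' (unitary A : Set A))
  have hbdd : BddAbove (l '' (unitary A : Set A)) := ⟨C, by rintro _ ⟨U, hU, rfl⟩; exact hl U hU⟩
  have hne : (l '' (unitary A : Set A)).Nonempty := ⟨_, 1, one_mem _, rfl⟩
  have hβ : ∀ U ∈ unitary A, l U ≤ β := fun U hU => le_csSup hbdd ⟨U, hU, rfl⟩
  -- From U + S = U₁ + U₂ comes l U + l S ≤ 2β; the supremum over U turns this into β + l S ≤ 2β.
  have hS : ∀ S : A, ‖S‖ < 1 → l S ≤ β := by
    intro S hS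
    have h1 : ∀ U ∈ unitary A, l U ≤ 2 * β - l S := by
      intro U hU
      obtain ⟨U₁, h₁, U₂, h₂, he⟩ := exists_unitary_add_eq hU hS
      have := congrArg l he
      rw [map_add, map_add] at this
      linarith [hβ _ h₁, hβ _ h₂]
    have h2 : β ≤ 2 * β - l S := csSup_le hne (by rintro _ ⟨U, hU, rfl⟩; exact h1 U hU)
    linarith
  -- The closed ball is reached by scaling W with r < 1 and letting r → 1.
  have hWβ : l W ≤ β := by
    have h1 : ∀ r ∈ Set.Ioo (0 : ℝ) 1, r * l W ≤ β := by
      intro r hr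
      have := hS (r • W) (by
        rw [norm_smul, Real.norm_of_nonneg hr.1.le]
        nlinarith [hr.1, hr.2, norm_nonneg W])
      simpa using this
    have hc : Filter.Tendsto (fun r : ℝ => r * l W) (nhdsWithin 1 (Set.Iio 1)) (nhds (1 * l W)) :=
      ((continuous_id.mul continuous_const).tendsto 1).mono_left nhdsWithin_le_nhds
    rw [one_mul] at hc
    refine le_of_tendsto hc ?_
    filter_upwards [Ioo_mem_nhdsLT (zero_lt_one' ℝ)] with r hr using h1 r hr
  have : β ≤ l W - ε := csSup_le hne (by rintro _ ⟨U, hU, rfl⟩; exact (hcon U hU).le)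
  linarith

end CStar

/-! ### Contractions between purifications, and isometric dilation. -/

section Hilbert

variable {H : Type*} [NormedAddCommGroup H] [InnerProductSpace ℂ H] [CompleteSpace H]

/-- The positive square root of an operator. -/
def sqrtOp (A : H →L[ℂ] H) : H →L[ℂ] H := CFC.sqrt A

theorem sqrtOp_nonneg (A : H →L[ℂ] H) : 0 ≤ sqrtOp A := CFC.sqrt_nonneg A

theorem adjoint_sqrtOp (A : H →L[ℂ] H) : ContinuousLinearMap.adjoint (sqrtOp A) = sqrtOp A :=
  adjoint_sqrt A

theorem sqrtOp_comp_sqrtOp {A : H →L[ℂ] H} (hA : 0 ≤ A) : sqrtOp A ∘L sqrtOp A = A :=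
  sqrt_comp_sqrt hA

/-- The assignment Y x ↦ Γ x is isometric on the range of Y; it extends to the closure and, via the
orthogonal projection, by zero to the complement. -/
theorem exists_contraction_comp_eq {Γ Y : H →L[ℂ] H} (hΓ : ∀ x, ‖Γ x‖ = ‖Y x‖) :
    ∃ U : H →L[ℂ] H, ‖U‖ ≤ 1 ∧ U ∘L Y = Γ := by
  set K := (LinearMap.range Y.toLinearMap).topologicalClosure
  have hmem : ∀ x, Y x ∈ K := fun x => Submodule.le_topologicalClosure _ ⟨x, rfl⟩
  let e : H →ₗ[ℂ] K := Y.toLinearMap.codRestrict K hmem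
  have hd : DenseRange e := by
    intro z
    rw [Metric.mem_closure_iff]
    intro ε hε
    have hz : (z : H) ∈ closure (LinearMap.range Y.toLinearMap : Set H) := z.2
    obtain ⟨_, ⟨x, rfl⟩, hx⟩ := Metric.mem_closure_iff.mp hz ε hε
    exact ⟨e x, ⟨x, rfl⟩, hx⟩
  have hn : ∀ x, ‖Γ.toLinearMap x‖ ≤ 1 * ‖e x‖ := fun x => by
    rw [one_mul]; exact (hΓ x).le
  have : CompleteSpace K := (Submodule.isClosed_topologicalClosure _).completeSpace_coe
  refine ⟨(Γ.toLinearMap.extendOfNorm e) ∘L K.orthogonalProjectionOnto, ?_, ?_⟩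
  · refine (ContinuousLinearMap.opNorm_comp_le _ _).trans ?_
    have h1 := LinearMap.opNorm_extendOfNorm_le hd zero_le_one hn
    have h2 := K.orthogonalProjectionOnto_norm_le
    nlinarith [norm_nonneg (Γ.toLinearMap.extendOfNorm e), norm_nonneg K.orthogonalProjectionOnto]
  · ext x
    have h1 : K.orthogonalProjectionOnto (Y x) = e x :=
      K.orthogonalProjectionOnto_mem_subspace_eq_self (e x)
    simp only [ContinuousLinearMap.comp_apply, h1]
    exact LinearMap.extendOfNorm_eq hd ⟨1, hn⟩ x

theorem norm_eq_of_adjoint_comp_eq {Γ Y : H →L[ℂ] H}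
    (he : ContinuousLinearMap.adjoint Γ ∘L Γ = ContinuousLinearMap.adjoint Y ∘L Y) (x : H) :
    ‖Γ x‖ = ‖Y x‖ := by
  have h1 := inner_self_apply_eq_norm_sq he x
  rw [inner_self_apply_eq_norm_sq rfl x] at h1
  exact ((sq_eq_sq₀ (norm_nonneg _) (norm_nonneg _)).mp (by exact_mod_cast h1)).symm

/-- An infinite basis index set is equipotent with two disjoint copies of itself, so the basis
splits into two halves, each a copy of the whole. -/
theorem exists_orthogonal_isometries (hH : ¬ FiniteDimensional ℂ H) :
    ∃ J₁ J₂ : H →ₗᵢ[ℂ] H, ∀ x y, inner ℂ (J₁ x) (J₂ y) = 0 := by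
  set ι := (exists_hilbertBasis ℂ H).choose
  let b : HilbertBasis ι ℂ H := stdBasis H
  have : Infinite ι := by
    by_contra hfin
    rw [not_infinite_iff_finite] at hfin
    have := Fintype.ofFinite ι
    exact hH b.toOrthonormalBasis.toBasis.finiteDimensional_of_finite
  obtain ⟨e⟩ : Nonempty (ι ⊕ ι ≃ ι) := by
    rw [← Cardinal.eq, Cardinal.mk_sum]
    simp
  have o₁ : Orthonormal ℂ fun i => b (e (Sum.inl i)) :=
    b.orthonormal.comp _ (e.injective.comp Sum.inl_injective)
  have o₂ : Orthonormal ℂ fun i => b (e (Sum.inr i)) :=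
    b.orthonormal.comp _ (e.injective.comp Sum.inr_injective)
  refine ⟨o₁.orthogonalFamily.linearIsometry.comp b.repr.toLinearIsometry,
    o₂.orthogonalFamily.linearIsometry.comp b.repr.toLinearIsometry, fun x y => ?_⟩
  have h₁ := o₁.orthogonalFamily.hasSum_linearIsometry (b.repr x)
  have h₂ := o₂.orthogonalFamily.hasSum_linearIsometry (b.repr y)
  have z : ∀ i j, inner ℂ (b (e (Sum.inl i))) (b (e (Sum.inr j))) = 0 := fun i j =>
    b.orthonormal.2 fun h => by simpa using e.injective h
  have s₁ : ∀ j, inner ℂ (b (e (Sum.inr j))) (o₁.orthogonalFamily.linearIsometry (b.repr x)) = 0 := by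
    intro j
    have := h₁.mapL (innerSL ℂ (b (e (Sum.inr j))))
    refine this.unique ?_
    convert hasSum_zero with i
    have := z i j
    rw [← inner_conj_symm, map_eq_zero] at this
    simp [this]
  have := h₂.mapL (innerSL ℂ (o₁.orthogonalFamily.linearIsometry (b.repr x)))
  refine this.unique ?_
  convert hasSum_zero with j
  have := s₁ j
  rw [← inner_conj_symm, map_eq_zero] at this
  simp [this]

/-- With isometries J₁, J₂ of orthogonal ranges and D = (1 - W†W)^{1/2}, take J = J₁ and V = J₁W +
J₂D. Then V†V = W†W + D² = 1, and the J₂ part is invisible to J†. -/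
theorem exists_dilation (hH : ¬ FiniteDimensional ℂ H) {W : H →L[ℂ] H} (hW : ‖W‖ ≤ 1) :
    ∃ J V : H →L[ℂ] H, ContinuousLinearMap.adjoint J ∘L J = 1 ∧
      ContinuousLinearMap.adjoint V ∘L V = 1 ∧ ContinuousLinearMap.adjoint J ∘L V = W := by
  obtain ⟨J₁, J₂, hJ⟩ := exists_orthogonal_isometries hH
  have hpos : 0 ≤ 1 - star W * W := by
    have h1 : 0 ≤ star W * W := star_mul_self_nonneg W
    rw [sub_nonneg, ← CStarAlgebra.norm_le_one_iff_of_nonneg _, CStarRing.norm_star_mul_self]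
    nlinarith [norm_nonneg W]
  set D := sqrtOp (1 - star W * W)
  have hD : ∀ x y, inner ℂ (D x) (D y) = inner ℂ x y - inner ℂ (W x) (W y) := by
    intro x y
    rw [← ContinuousLinearMap.adjoint_inner_right, adjoint_sqrtOp, ← ContinuousLinearMap.comp_apply,
      sqrtOp_comp_sqrtOp hpos, ← ContinuousLinearMap.adjoint_inner_right]
    simp [inner_sub_right, ContinuousLinearMap.star_eq_adjoint]
  have hJ' : ∀ x y, inner ℂ (J₂ x) (J₁ y) = 0 := fun x y => by
    rw [← inner_conj_symm, hJ, map_zero]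
  have hext : ∀ {S T : H →L[ℂ] H},
      (∀ x y, inner ℂ x (S y) = inner ℂ x (T y)) → S = T := fun H =>
    ContinuousLinearMap.ext fun y => ext_inner_left ℂ fun x => H x y
  refine ⟨J₁.toContinuousLinearMap,
    J₁.toContinuousLinearMap ∘L W + J₂.toContinuousLinearMap ∘L D, hext fun x y => ?_,
    hext fun x y => ?_, hext fun x y => ?_⟩
  · simp
  · simp [ContinuousLinearMap.adjoint_inner_right, hJ, hJ', hD]
  · simp [ContinuousLinearMap.adjoint_inner_right, hJ]

end Hilbert

/-! ### Minimax over contractions in the weak operator topology. -/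

section Minimax

/-- A minimax theorem for functions affine in each variable: the second variable ranges over a type
in which convex combinations exist. -/
theorem exists_forall_ge_of_forall_exists_ge {E S : Type*} [AddCommGroup E] [Module ℝ E]
    [TopologicalSpace E] [IsTopologicalAddGroup E] [ContinuousSMul ℝ E] {K : Set E}
    (hne : K.Nonempty) (hconv : Convex ℝ K) (hcomp : IsCompact K) (f : E → S → ℝ)
    (hcont : ∀ ρ, ContinuousOn (fun x => f x ρ) K)
    (haff : ∀ ρ, ConcaveOn ℝ K fun x => f x ρ)
    (hmix : ∀ ρ σ : S, ∀ s t : ℝ, 0 ≤ s → 0 ≤ t → s + t = 1 →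
      ∃ τ, ∀ x ∈ K, f x τ = s * f x ρ + t * f x σ)
    {c : ℝ} (hc : ∀ ρ, ∃ x ∈ K, c ≤ f x ρ) : ∃ x ∈ K, ∀ ρ, c ≤ f x ρ := by
  by_contra! hcon
  obtain ⟨x₀, hx₀⟩ := hne
  have : Nonempty S := ⟨(hcon x₀ hx₀).choose⟩
  choose! r hr using hcon
  -- If every x fails at some state, compactness leaves finitely many states such that every x fails
  -- at one of them; the finite form of Sion's theorem then gives a single state at which all x
  -- fail.
  obtain ⟨T, hTK, hT⟩ := hcomp.elim_nhdsWithin_subcover (fun x => {y | f y (r x) < c})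
    (fun x hx => (hcont (r x) x hx).preimage_mem_nhdsWithin (Iio_mem_nhds (hr x hx)))
  -- The type of states carries no linear structure, so it is replaced by the convex set of
  -- functions that states induce on K.
  let Y : Set (E → ℝ) := {φ | ∃ ρ, ∀ x ∈ K, φ x = f x ρ}
  have hYconv : Convex ℝ Y := by
    rintro φ ⟨ρ, hρ⟩ ψ ⟨σ, hσ⟩ s t hs ht hst
    obtain ⟨τ, hτ⟩ := hmix ρ σ s t hs ht hst
    exact ⟨τ, fun x hx => by simp [hρ x hx, hσ x hx, hτ x hx]⟩
  obtain ⟨φ, ⟨ρ, hρ⟩, h⟩ := Sion.exists_lt_iInf_of_lt_iInf_of_finite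
    (X := K) (Y := Y) (f := fun x φ => -φ x) ⟨x₀, hx₀⟩ hcomp
    (by
      rintro φ ⟨ρ, hρ⟩
      exact ((hcont ρ).congr hρ).neg.lowerSemicontinuousOn)
    (by
      rintro φ ⟨ρ, hρ⟩
      refine ConvexOn.quasiconvexOn ?_
      have h1 : ConcaveOn ℝ K φ := (haff ρ).congr fun x hx => (hρ x hx).symm
      exact h1.neg)
    hYconv
    (fun x hx => ((continuous_apply x).neg).upperSemicontinuous.upperSemicontinuousOn _)
    (by
      intro x hx
      refine ConcaveOn.quasiconcaveOn ?_
      refine ⟨hYconv, fun φ _ ψ _ s t _ _ _ => ?_⟩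
      simp only [Pi.add_apply, Pi.smul_apply, smul_eq_mul]
      linarith)
    hconv (s := (fun x => (fun y => f y (r x) : E → ℝ)) '' (T : Set E))
    (T.finite_toSet.image _) (by rintro _ ⟨x, hx, rfl⟩; exact ⟨r x, fun _ _ => rfl⟩) (t := -c)
    (by
      intro x hx
      obtain ⟨y, hy, hxy⟩ := Set.mem_iUnion₂.mp (hT hx)
      exact ⟨_, ⟨y, hy, rfl⟩, neg_lt_neg hxy⟩)
  obtain ⟨x, hx, hcx⟩ := hc ρ
  have := h x hx
  rw [hρ x hx] at this
  linarith

variable {H : Type*} [NormedAddCommGroup H] [InnerProductSpace ℂ H] [CompleteSpace H]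

/-- The matrix element function of an operator. -/
def matrixElements (W : H →L[ℂ] H) : H × H → ℂ := fun p => inner ℂ p.1 (W p.2)

/-- The unit ball of the bounded operators is compact in the weak operator topology. -/
theorem isCompact_matrixElements_closedBall :
    IsCompact (matrixElements '' Metric.closedBall (0 : H →L[ℂ] H) 1) := by
  have hpi : IsCompact (Set.univ.pi fun p : H × H => Metric.closedBall (0 : ℂ) (‖p.1‖ * ‖p.2‖)) :=
    isCompact_univ_pi fun p => isCompact_closedBall _ _
  -- Matrix element functions of contractions are exactly the sesquilinear φ with |φ(x, y)| ≤
  -- ‖x‖‖y‖: a closed subset of a product of discs, compact by Tychonoff.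
  have hcl : IsClosed {φ : H × H → ℂ | (∀ x x' y, φ (x + x', y) = φ (x, y) + φ (x', y)) ∧
      (∀ (c : ℂ) x y, φ (c • x, y) = starRingEnd ℂ c * φ (x, y)) ∧
      (∀ x y y', φ (x, y + y') = φ (x, y) + φ (x, y')) ∧
      (∀ (c : ℂ) x y, φ (x, c • y) = c * φ (x, y))} := by
    simp only [Set.ofPred_and, Set.ofPred_forall]
    refine IsClosed.inter ?_ (IsClosed.inter ?_ (IsClosed.inter ?_ ?_)) <;>
    exact isClosed_iInter fun _ => isClosed_iInter fun _ => isClosed_iInter fun _ =>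
      isClosed_eq (by fun_prop) (by fun_prop)
  convert hpi.inter_right hcl using 1
  ext φ
  constructor
  · rintro ⟨W, hW, rfl⟩
    rw [mem_closedBall_zero_iff] at hW
    refine ⟨fun p _ => ?_, ?_, ?_, ?_, ?_⟩
    · rw [mem_closedBall_zero_iff]
      refine (norm_inner_le_norm _ _).trans ?_
      gcongr
      exact (W.le_opNorm _).trans (by nlinarith [norm_nonneg p.2])
    · intro x x' y; simp [matrixElements]
    · intro c x y; simp [matrixElements, mul_comm]
    · intro x y y'; simp [matrixElements]
    · intro c x y; simp [matrixElements]
  · rintro ⟨hb, h1, h2, h3, h4⟩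
    let B : H →ₗ⋆[ℂ] H →ₗ[ℂ] ℂ := LinearMap.mk₂'ₛₗ (starRingEnd ℂ) (RingHom.id ℂ)
      (fun x y => φ (x, y)) h1 h2 h3 h4
    have hB : ∀ x y, ‖B x y‖ ≤ 1 * ‖x‖ * ‖y‖ := fun x y => by
      rw [one_mul]
      exact mem_closedBall_zero_iff.mp (hb (x, y) trivial)
    let T := InnerProductSpace.continuousLinearMapOfBilin (B.mkContinuous₂ 1 hB)
    have hT : ∀ x y, inner ℂ (T x) y = φ (x, y) := fun x y =>
      InnerProductSpace.continuousLinearMapOfBilin_apply _ x y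
    refine ⟨ContinuousLinearMap.adjoint T, ?_, ?_⟩
    · rw [mem_closedBall_zero_iff, LinearIsometryEquiv.norm_map]
      refine ContinuousLinearMap.opNorm_le_bound _ zero_le_one fun x => ?_
      by_cases hx : T x = 0
      · rw [hx, norm_zero]; positivity
      have h5 := hB x (T x)
      have h6 : B x (T x) = inner ℂ (T x) (T x) := (hT x (T x)).symm
      rw [h6, inner_self_eq_norm_sq_to_K] at h5
      have h7 : 0 < ‖T x‖ := norm_pos_iff.mpr hx
      simp only [norm_pow, RCLike.norm_ofReal, abs_norm] at h5
      nlinarith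
    · funext p
      rw [matrixElements, ContinuousLinearMap.adjoint_inner_right, hT]

/-- On the unit ball the terms are dominated by ‖u i‖‖v i‖ uniformly in W, so each weighted sum is
weakly continuous and affine in W, and the abstract minimax theorem applies. -/
theorem exists_contraction_forall_ge {S ι : Type*} (u v : S → ι → H)
    (hu : ∀ ρ, Summable fun i => ‖u ρ i‖ ^ 2) (hv : ∀ ρ, Summable fun i => ‖v ρ i‖ ^ 2)
    (hmix : ∀ ρ σ : S, ∀ s t : ℝ, 0 ≤ s → 0 ≤ t → s + t = 1 →
      ∃ τ, ∀ W : H →L[ℂ] H, (∑' i, inner ℂ (u τ i) (W (v τ i))).re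
        = s * (∑' i, inner ℂ (u ρ i) (W (v ρ i))).re + t * (∑' i, inner ℂ (u σ i) (W (v σ i))).re)
    {c : ℝ} (hc : ∀ ρ, ∃ W : H →L[ℂ] H, ‖W‖ ≤ 1 ∧ c ≤ (∑' i, inner ℂ (u ρ i) (W (v ρ i))).re) :
    ∃ W : H →L[ℂ] H, ‖W‖ ≤ 1 ∧ ∀ ρ, c ≤ (∑' i, inner ℂ (u ρ i) (W (v ρ i))).re := by
  have hconv : Convex ℝ (matrixElements '' Metric.closedBall (0 : H →L[ℂ] H) 1) := by
    rintro _ ⟨W, hW, rfl⟩ _ ⟨W', hW', rfl⟩ s t hs ht hst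
    refine ⟨s • W + t • W', convex_closedBall _ _ hW hW' hs ht hst, ?_⟩
    funext p
    simp [matrixElements, ← Complex.coe_smul]
  have hbound : ∀ φ ∈ matrixElements '' Metric.closedBall (0 : H →L[ℂ] H) 1, ∀ p : H × H,
      ‖φ p‖ ≤ ‖p.1‖ * ‖p.2‖ := by
    rintro _ ⟨W, hW, rfl⟩ p
    rw [mem_closedBall_zero_iff] at hW
    refine (norm_inner_le_norm _ _).trans ?_
    gcongr
    exact (W.le_opNorm _).trans (by nlinarith [norm_nonneg p.2])
  have hsum : ∀ φ ∈ matrixElements '' Metric.closedBall (0 : H →L[ℂ] H) 1, ∀ ρ,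
      Summable fun i => φ (u ρ i, v ρ i) := fun φ hφ ρ =>
    Summable.of_norm_bounded (summable_norm_mul_norm (hu ρ) (hv ρ)) fun i => hbound φ hφ _
  obtain ⟨φ, ⟨W, hW, rfl⟩, h⟩ := exists_forall_ge_of_forall_exists_ge
    (K := matrixElements '' Metric.closedBall (0 : H →L[ℂ] H) 1)
    ⟨_, 0, Metric.mem_closedBall_self zero_le_one, rfl⟩ hconv
    isCompact_matrixElements_closedBall (fun φ ρ => (∑' i, φ (u ρ i, v ρ i)).re)
    (fun ρ => by
      refine Complex.continuous_re.comp_continuousOn ?_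
      exact continuousOn_tsum (fun i => (continuous_apply _).continuousOn)
        (summable_norm_mul_norm (hu ρ) (hv ρ)) fun i φ hφ => hbound φ hφ _)
    (fun ρ => by
      refine ⟨hconv, fun φ hφ ψ hψ s t hs ht hst => le_of_eq ?_⟩
      have e : ∀ i, (s • φ + t • ψ) (u ρ i, v ρ i)
          = s • φ (u ρ i, v ρ i) + t • ψ (u ρ i, v ρ i) := fun i => rfl
      simp only [e]
      rw [((hsum φ hφ ρ).const_smul s).tsum_add ((hsum ψ hψ ρ).const_smul t),
        (hsum φ hφ ρ).tsum_const_smul s, (hsum ψ hψ ρ).tsum_const_smul t]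
      simp)
    (fun ρ σ s t hs ht hst => by
      obtain ⟨τ, hτ⟩ := hmix ρ σ s t hs ht hst
      exact ⟨τ, by rintro _ ⟨W, -, rfl⟩; exact hτ W⟩)
    (fun ρ => by
      obtain ⟨W, hW, h⟩ := hc ρ
      exact ⟨_, ⟨W, mem_closedBall_zero_iff.mpr hW, rfl⟩, h⟩)
  exact ⟨W, mem_closedBall_zero_iff.mp hW, h⟩

end Minimax

/-! ### Finite dimension: the state space and unitary maximizers. -/

section FiniteDimensional

variable {E : Type*} [NormedAddCommGroup E] [InnerProductSpace ℂ E] [CompleteSpace E]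

theorem finite_stdBasis_index (E : Type*) [NormedAddCommGroup E] [InnerProductSpace ℂ E]
    [CompleteSpace E] [FiniteDimensional ℂ E] : Finite (exists_hilbertBasis ℂ E).choose :=
  (stdBasis E).orthonormal.linearIndependent.finite

theorem continuous_trace [FiniteDimensional ℂ E] : Continuous (trace : (E →L[ℂ] E) → ℂ) := by
  have := finite_stdBasis_index E
  have := Fintype.ofFinite (exists_hilbertBasis ℂ E).choose
  unfold trace
  simp only [tsum_fintype]
  fun_prop

theorem hasSum_trace [FiniteDimensional ℂ E] (T : E →L[ℂ] E) :
    HasSum (fun i => inner ℂ (stdBasis E i) (T (stdBasis E i))) (trace T) := by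
  have := finite_stdBasis_index E
  have := Fintype.ofFinite (exists_hilbertBasis ℂ E).choose
  exact (hasSum_fintype _).summable.hasSum

theorem trace_add [FiniteDimensional ℂ E] (S T : E →L[ℂ] E) :
    trace (S + T) = trace S + trace T := by
  refine HasSum.tsum_eq ?_
  simpa [inner_add_right] using (hasSum_trace S).add (hasSum_trace T)

theorem trace_smul [FiniteDimensional ℂ E] (c : ℂ) (T : E →L[ℂ] E) :
    trace (c • T) = c * trace T := by
  refine HasSum.tsum_eq ?_
  simpa [inner_smul_right] using (hasSum_trace T).mul_left c

theorem trace_real_smul [FiniteDimensional ℂ E] (c : ℝ) (T : E →L[ℂ] E) :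
    trace (c • T) = c * trace T := by
  rw [← Complex.coe_smul, trace_smul]

/-- In finite dimension, a contraction maximizing `Re Tr (W M)` with `M` invertible is unitary. -/
theorem adjoint_comp_eq_one_of_forall_trace_le [FiniteDimensional ℂ E] {M V : E →L[ℂ] E}
    (hM : IsUnit M) (hV : ‖V‖ ≤ 1)
    (hmax : ∀ W : E →L[ℂ] E, ‖W‖ ≤ 1 → (trace (W * M)).re ≤ (trace (V * M)).re) :
    ContinuousLinearMap.adjoint V ∘L V = 1 := by
  have := finite_stdBasis_index E
  have := Fintype.ofFinite (exists_hilbertBasis ℂ E).choose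
  obtain ⟨U, hU, hpol, hunit⟩ := exists_unitary_polar hM
  set Q := CFC.sqrt (CFC.abs M)
  have hQQ : Q * Q = CFC.abs M := CFC.sqrt_mul_sqrt_self _ (CFC.abs_nonneg M)
  have hQ : IsUnit Q := (CFC.isUnit_sqrt_iff _ (CFC.abs_nonneg M)).mpr hunit
  have hQa : ContinuousLinearMap.adjoint Q = Q := adjoint_sqrt _
  have hUn : ∀ B ∈ unitary (E →L[ℂ] E), ‖B‖ ≤ 1 := fun B hB => by
    have h1 : star B * B = 1 := Unitary.star_mul_self_of_mem hB
    have h2 := CStarRing.norm_star_mul_self (x := B)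
    rw [h1] at h2
    have h3 : ‖(1 : E →L[ℂ] E)‖ ≤ 1 := ContinuousLinearMap.norm_id_le
    nlinarith [norm_nonneg B]
  -- With M = U|M| and Q = |M|^{1/2}, Tr(VM) = Σ ⟨Q e, Z Q e⟩ is at most Σ ‖Q e‖² in real part, the
  -- value at W = U†. Maximality forces equality in every term, hence Z Q e = Q e; invertibility of
  -- Q then gives V U = 1.
  set Z := V * U
  have hZn : ‖Z‖ ≤ 1 := (norm_mul_le _ _).trans (by
    nlinarith [hUn U hU, norm_nonneg V, norm_nonneg U])
  have htr : ∀ B : E →L[ℂ] E, trace (B * Q * Q)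
      = ∑ i, inner ℂ (Q (stdBasis E i)) (B (Q (stdBasis E i))) := by
    intro B
    have := trace_comp_adjoint (stdBasis E) (B * Q) Q (hasSum_fintype _).summable
      (hasSum_fintype _).summable
    rw [hQa, tsum_fintype] at this
    exact this
  have h1 := hmax (star U) (hUn _ (Unitary.star_mem hU))
  have e1 : star U * M = 1 * Q * Q := by
    rw [one_mul, hQQ]
    nth_rewrite 1 [hpol]
    rw [← mul_assoc, Unitary.star_mul_self_of_mem hU, one_mul]
  have e2 : V * M = Z * Q * Q := by
    rw [mul_assoc Z, hQQ]
    nth_rewrite 1 [hpol]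
    rw [← mul_assoc]
  rw [e1, e2, htr, htr, Complex.re_sum, Complex.re_sum] at h1
  have hle : ∀ x : E, (inner ℂ x (Z x)).re ≤ ‖x‖ ^ 2 := fun x => by
    refine (Complex.re_le_norm _).trans ((norm_inner_le_norm _ _).trans ?_)
    have := Z.le_opNorm x
    nlinarith [norm_nonneg x, norm_nonneg (Z x)]
  have hone : ∀ x : E, (inner ℂ x ((1 : E →L[ℂ] E) x)).re = ‖x‖ ^ 2 := fun x => by
    rw [one_apply_eq_self, inner_self_eq_norm_sq_to_K]
    norm_cast
  simp only [hone] at h1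
  have heq := (Finset.sum_eq_sum_iff_of_le fun i _ => hle (Q (stdBasis E i))).mp
    (le_antisymm (Finset.sum_le_sum fun i _ => hle _) h1)
  have hZQ : ∀ i, Z (Q (stdBasis E i)) = Q (stdBasis E i) := by
    intro i
    set x := Q (stdBasis E i)
    have h2 : (inner ℂ x (Z x)).re = ‖x‖ ^ 2 := heq i (Finset.mem_univ i)
    have h3 := norm_sub_sq (𝕜 := ℂ) x (Z x)
    have h4 : ‖Z x‖ ≤ ‖x‖ := (Z.le_opNorm x).trans (by nlinarith [norm_nonneg x])
    have h5 : ‖x - Z x‖ ^ 2 ≤ 0 := by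
      rw [h3, RCLike.re_to_complex, h2]
      nlinarith [norm_nonneg x, norm_nonneg (Z x)]
    have h6 : ‖x - Z x‖ = 0 := by
      have := norm_nonneg (x - Z x)
      exact pow_eq_zero_iff two_ne_zero |>.mp (le_antisymm h5 (by positivity))
    exact (sub_eq_zero.mp (norm_eq_zero.mp h6)).symm
  have hZQ' : Z * Q = 1 * Q := by
    refine ContinuousLinearMap.ext_on (s := Set.range (stdBasis E)) ?_ ?_
    · rw [Submodule.dense_iff_topologicalClosure_eq_top]
      exact (stdBasis E).dense_span
    · rintro _ ⟨i, rfl⟩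
      exact hZQ i
  have hZ : V * U = 1 := hQ.mul_right_cancel hZQ'
  have hVU : V = star U := by
    calc V = V * (U * star U) := by rw [Unitary.mul_star_self_of_mem hU, mul_one]
      _ = star U := by rw [← mul_assoc, hZ, one_mul]
  change star V * V = 1
  rw [hVU, star_star]
  exact Unitary.mul_star_self_of_mem hU

theorem NormalState.norm_amplitude_le (ρ : NormalState E) : ‖ρ.amplitude‖ ≤ 1 := by
  refine ContinuousLinearMap.opNorm_le_bound _ zero_le_one fun x => ?_
  rw [one_mul]
  have h1 := hasSum_norm_inner_sq (stdBasis E) (ρ.amplitude x)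
  have h2 := ρ.hasSum_norm_sq_amplitude.mul_right (‖x‖ ^ 2)
  rw [one_mul] at h2
  have h3 : ‖ρ.amplitude x‖ ^ 2 ≤ ‖x‖ ^ 2 := by
    refine hasSum_le (fun i => ?_) h1 h2
    rw [← ContinuousLinearMap.adjoint_inner_left, ρ.adjoint_amplitude, ← mul_pow]
    exact pow_le_pow_left₀ (norm_nonneg _) (norm_inner_le_norm _ _) 2
  exact (sq_le_sq₀ (norm_nonneg _) (norm_nonneg _)).mp h3

theorem NormalState.norm_density_le (ρ : NormalState E) : ‖ρ.density‖ ≤ 1 := by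
  rw [← ρ.amplitude_comp_amplitude]
  refine (ContinuousLinearMap.opNorm_comp_le _ _).trans ?_
  nlinarith [ρ.norm_amplitude_le, norm_nonneg ρ.amplitude]

theorem range_density_eq [FiniteDimensional ℂ E] :
    Set.range (NormalState.density (E := E)) = {D : E →L[ℂ] E | 0 ≤ D ∧ trace D = 1} := by
  ext D
  constructor
  · rintro ⟨ρ, rfl⟩
    exact ⟨ρ.nonneg, ρ.trace_eq_one⟩
  · rintro ⟨h0, h1⟩
    exact ⟨NormalState.ofHasSum D h0 (h1 ▸ hasSum_trace D), rfl⟩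

theorem isCompact_range_density [FiniteDimensional ℂ E] :
    IsCompact (Set.range (NormalState.density (E := E))) := by
  have : ProperSpace (E →L[ℂ] E) := FiniteDimensional.proper ℂ _
  refine Metric.isCompact_of_isClosed_isBounded ?_ ?_
  · rw [range_density_eq]
    exact isClosed_Ici.inter (isClosed_eq continuous_trace continuous_const)
  · refine (Metric.isBounded_closedBall (x := (0 : E →L[ℂ] E)) (r := 1)).subset ?_
    rintro _ ⟨ρ, rfl⟩
    exact mem_closedBall_zero_iff.mpr ρ.norm_density_le

theorem convex_range_density : Convex ℝ (Set.range (NormalState.density (E := E))) := by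
  rintro _ ⟨ρ, rfl⟩ _ ⟨σ, rfl⟩ s t hs ht hst
  exact ⟨ρ.mix σ s t hs ht hst, by simp [NormalState.mix, NormalState.ofHasSum]⟩

/-- The maximally mixed state; mixing a little of it into any state makes the density invertible. -/
theorem exists_density_eq_smul_one [FiniteDimensional ℂ E] [Nontrivial E] :
    ∃ (τ : NormalState E) (c : ℝ), 0 < c ∧ τ.density = c • (1 : E →L[ℂ] E) := by
  have := finite_stdBasis_index E
  have := Fintype.ofFinite (exists_hilbertBasis ℂ E).choose
  have hne : Nonempty (exists_hilbertBasis ℂ E).choose := by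
    by_contra hempty
    rw [not_nonempty_iff] at hempty
    obtain ⟨x, hx⟩ := exists_ne (0 : E)
    have h1 := hasSum_norm_inner_sq (stdBasis E) x
    have h2 := h1.unique hasSum_empty
    exact hx (by simpa using h2)
  set n := Fintype.card (exists_hilbertBasis ℂ E).choose
  have hn : (0 : ℝ) < n := by exact_mod_cast Fintype.card_pos
  have hone : trace (1 : E →L[ℂ] E) = n := by
    unfold trace
    simp [tsum_fintype, inner_self_eq_norm_sq_to_K, (stdBasis E).orthonormal.1, n]
  refine ⟨NormalState.ofHasSum ((n : ℝ)⁻¹ • (1 : E →L[ℂ] E))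
    (smul_nonneg (by positivity) zero_le_one) ?_, (n : ℝ)⁻¹, by positivity, rfl⟩
  convert hasSum_trace ((n : ℝ)⁻¹ • (1 : E →L[ℂ] E)) using 1
  rw [← Complex.coe_smul, trace_smul, hone]
  have : (n : ℂ) ≠ 0 := by exact_mod_cast hn.ne'
  push_cast
  field_simp

theorem isUnit_of_smul_one_le {T : E →L[ℂ] E} {c : ℝ} (hc : 0 < c)
    (hT : c • (1 : E →L[ℂ] E) ≤ T) : IsUnit T := by
  refine CStarAlgebra.isUnit_of_le (c • (1 : E →L[ℂ] E)) hT ?_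
  refine IsStrictlyPositive.smul hc ?_
  exact isStrictlyPositive_one

end FiniteDimensional

/-! ### The ampliation A ↦ A ⊗ 1 preserves invertibility. -/

section AmpliationUnit

variable {g : Type*} [NormedAddCommGroup g] [InnerProductSpace ℂ g]
variable {h : Type*} [NormedAddCommGroup h] [InnerProductSpace ℂ h]

variable (g h) in
/-- The linear map `A ↦ A ⊗ 1`. -/
def opTensorLeft : (g →L[ℂ] g) →ₗ[ℂ] (HTensor g h →L[ℂ] HTensor g h) where
  toFun A := opTensor A 1
  map_add' A A' := opTensor_add_left A A' 1
  map_smul' c A := opTensor_smul_left c A 1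

theorem isUnit_opTensor_one {A : g →L[ℂ] g} (hA : IsUnit A) :
    IsUnit (opTensor A (1 : h →L[ℂ] h)) := by
  obtain ⟨u, rfl⟩ := hA
  have h1 : opTensor (u : g →L[ℂ] g) (1 : h →L[ℂ] h) * opTensor ((u⁻¹ : (g →L[ℂ] g)ˣ) : g →L[ℂ] g) 1
      = 1 := by
    have := opTensor_comp (u : g →L[ℂ] g) ((u⁻¹ : (g →L[ℂ] g)ˣ) : g →L[ℂ] g) (1 : h →L[ℂ] h) 1
    change _ = opTensor _ _ * opTensor _ _ at this
    rw [← this]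
    change opTensor ((u : g →L[ℂ] g) * ((u⁻¹ : (g →L[ℂ] g)ˣ) : g →L[ℂ] g)) (1 * 1) = 1
    rw [Units.mul_inv, one_mul, opTensor_one_one]
  have h2 : opTensor ((u⁻¹ : (g →L[ℂ] g)ˣ) : g →L[ℂ] g) (1 : h →L[ℂ] h) * opTensor (u : g →L[ℂ] g) 1
      = 1 := by
    have := opTensor_comp ((u⁻¹ : (g →L[ℂ] g)ˣ) : g →L[ℂ] g) (u : g →L[ℂ] g) (1 : h →L[ℂ] h) 1
    change _ = opTensor _ _ * opTensor _ _ at this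
    rw [← this]
    change opTensor (((u⁻¹ : (g →L[ℂ] g)ˣ) : g →L[ℂ] g) * (u : g →L[ℂ] g)) (1 * 1) = 1
    rw [Units.inv_mul, one_mul, opTensor_one_one]
  exact ⟨⟨_, _, h1, h2⟩, rfl⟩

end AmpliationUnit

/-! ### Unitary saddle points in finite dimension. -/

section Saddle

variable {g : Type*} [NormedAddCommGroup g] [InnerProductSpace ℂ g] [CompleteSpace g]
variable {H : Type*} [NormedAddCommGroup H] [InnerProductSpace ℂ H] [CompleteSpace H]
variable [FiniteDimensional ℂ g] [FiniteDimensional ℂ H]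

/-- Joint continuity in perturbation size, contraction and density serves both Sion's theorem at
fixed size and the limit of vanishing size. -/
theorem continuous_trace_sandwich (Λ : (g →L[ℂ] g) →ₗ[ℂ] H →L[ℂ] H)
    (X Y : H →L[ℂ] H) (T : g →L[ℂ] g) :
    Continuous fun q : ℝ × (H →L[ℂ] H) × (g →L[ℂ] g) =>
      (trace (q.2.1 * ((X + q.1 • 1) * Λ ((1 - q.1) • q.2.2 + q.1 • T)
        * (Y + q.1 • 1)))).re := by
  have hc : Continuous fun A : g →L[ℂ] g => Λ A :=
    Λ.continuous_of_finiteDimensional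
  have h2 : Continuous fun q : ℝ × (H →L[ℂ] H) × (g →L[ℂ] g) =>
      Λ ((1 - q.1) • q.2.2 + q.1 • T) := hc.comp (by fun_prop)
  refine Complex.continuous_re.comp (continuous_trace.comp ?_)
  exact (continuous_fst.comp continuous_snd).mul
    (((continuous_const.add (continuous_fst.smul continuous_const)).mul h2).mul
      (continuous_const.add (continuous_fst.smul continuous_const)))

/-- The perturbed saddle point problem has a saddle point whose contraction is unitary. -/
theorem exists_unitary_saddle (Λ : (g →L[ℂ] g) →ₗ[ℂ] H →L[ℂ] H)
    (hΛ : ∀ A, IsUnit A → IsUnit (Λ A)) {X Y : H →L[ℂ] H} (hX : 0 ≤ X) (hY : 0 ≤ Y)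
    (τ : NormalState g) {c : ℝ} (hc : 0 < c) (hτ : τ.density = c • (1 : g →L[ℂ] g))
    {ε : ℝ} (hε : 0 < ε) (hε1 : ε ≤ 1) (W₀ : H →L[ℂ] H) (hW₀ : ‖W₀‖ ≤ 1) :
    ∃ V : H →L[ℂ] H, ‖V‖ ≤ 1 ∧ ContinuousLinearMap.adjoint V ∘L V = 1 ∧
      ∃ σ : NormalState g, ∀ ρ : NormalState g,
      (trace (W₀ * ((X + ε • 1) * Λ ((1 - ε) • σ.density + ε • τ.density)
        * (Y + ε • 1)))).re
      ≤ (trace (V * ((X + ε • 1) * Λ ((1 - ε) • ρ.density + ε • τ.density)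
        * (Y + ε • 1)))).re := by
  have : ProperSpace (H →L[ℂ] H) := FiniteDimensional.proper ℂ _
  set f : (g →L[ℂ] g) → (H →L[ℂ] H) → ℝ := fun D W =>
    (trace (W * ((X + ε • 1) * Λ ((1 - ε) • D + ε • τ.density) * (Y + ε • 1)))).re with hf
  have hfc : Continuous fun q : (H →L[ℂ] H) × (g →L[ℂ] g) => f q.2 q.1 :=
    (continuous_trace_sandwich Λ X Y τ.density).comp (Continuous.prodMk_right ε)
  have hW : ∀ D W W' (s t : ℝ), f D (s • W + t • W') = s * f D W + t * f D W' := by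
    intro D W W' s t
    simp only [hf]
    rw [add_mul, smul_mul_assoc, smul_mul_assoc, trace_add, trace_real_smul, trace_real_smul]
    simp
  have hD : ∀ D D' W (s t : ℝ), s + t = 1 → f (s • D + t • D') W = s * f D W + t * f D' W := by
    intro D D' W s t hst
    have e : (1 - ε) • (s • D + t • D') + ε • τ.density
        = (s : ℂ) • ((1 - ε) • D + ε • τ.density) + (t : ℂ) • ((1 - ε) • D' + ε • τ.density) := by
      simp only [Complex.coe_smul]
      have : s = 1 - t := by linarith
      subst this
      module
    simp only [hf]
    rw [e, map_add, map_smul, map_smul]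
    generalize X + ε • 1 = A
    generalize Y + ε • 1 = B
    simp only [mul_add, add_mul, smul_mul_assoc, mul_smul_comm, trace_add, trace_smul,
      Complex.add_re, Complex.re_ofReal_mul]
  obtain ⟨_, ⟨σ, rfl⟩, V, hV, hsad⟩ := Sion.exists_isSaddlePointOn
    (X := Set.range (NormalState.density (E := g)))
    (Y := Metric.closedBall (0 : H →L[ℂ] H) 1) (f := f)
    ⟨_, τ, rfl⟩ convex_range_density isCompact_range_density
    (fun W _ => (hfc.comp (Continuous.prodMk_right W)).lowerSemicontinuous.lowerSemicontinuousOn _)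
    (fun W _ => ConvexOn.quasiconvexOn ⟨convex_range_density, fun D _ D' _ s t _ _ hst =>
      (hD D D' W s t hst).le⟩)
    (convex_closedBall _ _) ⟨0, Metric.mem_closedBall_self zero_le_one⟩ (isCompact_closedBall _ _)
    (fun D _ => (hfc.comp (Continuous.prodMk_left D)).upperSemicontinuous.upperSemicontinuousOn _)
    (fun D _ => ConcaveOn.quasiconcaveOn ⟨convex_closedBall _ _, fun W _ W' _ s t _ _ hst =>
      (hW D W W' s t).ge⟩)
  rw [mem_closedBall_zero_iff] at hV
  -- This is the purpose of the perturbation: all three factors are invertible, so the maximizing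
  -- contraction V must be unitary.
  have hM : IsUnit ((X + ε • 1) * Λ ((1 - ε) • σ.density + ε • τ.density)
      * (Y + ε • 1)) := by
    refine IsUnit.mul (IsUnit.mul ?_ (hΛ _ ?_)) ?_
    · exact isUnit_of_smul_one_le hε (le_add_of_nonneg_left hX)
    · refine isUnit_of_smul_one_le (mul_pos hε hc) ?_
      rw [hτ, smul_smul]
      exact le_add_of_nonneg_left (smul_nonneg (by linarith) σ.nonneg)
    · exact isUnit_of_smul_one_le hε (le_add_of_nonneg_left hY)
  refine ⟨V, hV, adjoint_comp_eq_one_of_forall_trace_le hM hV fun W hW => ?_, σ, fun ρ => ?_⟩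
  · exact hsad _ ⟨σ, rfl⟩ W (mem_closedBall_zero_iff.mpr hW)
  · exact hsad _ ⟨ρ, rfl⟩ W₀ (mem_closedBall_zero_iff.mpr hW₀)

/-- In finite dimension, a lower bound valid for one contraction and all states is also valid for
some unitary and all states. -/
theorem exists_unitary_forall_trace_ge [Nontrivial g]
    (Λ : (g →L[ℂ] g) →ₗ[ℂ] H →L[ℂ] H)
    (hΛ : ∀ A, IsUnit A → IsUnit (Λ A)) {X Y : H →L[ℂ] H}
    (hX : 0 ≤ X) (hY : 0 ≤ Y) {W₀ : H →L[ℂ] H} (hW₀ : ‖W₀‖ ≤ 1) {s : ℝ}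
    (hs : ∀ ρ : NormalState g, s ≤ (trace (W₀ ∘L X ∘L Λ ρ.density ∘L Y)).re) :
    ∃ V : H →L[ℂ] H, ContinuousLinearMap.adjoint V ∘L V = 1 ∧
      ∀ ρ : NormalState g, s ≤ (trace (V ∘L X ∘L Λ ρ.density ∘L Y)).re := by
  have : ProperSpace (H →L[ℂ] H) := FiniteDimensional.proper ℂ _
  obtain ⟨τ, c, hc, hτ⟩ := exists_density_eq_smul_one (E := g)
  have hε : ∀ n : ℕ, 0 < 1 / ((n : ℝ) + 1) ∧ 1 / ((n : ℝ) + 1) ≤ 1 := fun n =>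
    ⟨by positivity, by rw [div_le_one (by positivity)]; linarith [Nat.cast_nonneg (α := ℝ) n]⟩
  choose V hVn hV σ hσ using fun n : ℕ =>
    exists_unitary_saddle Λ hΛ hX hY τ hc hτ (hε n).1 (hε n).2 W₀ hW₀
  -- Contractions and states converge along a common subsequence. In the limit the saddle inequality
  -- compares W₀ at σ' with V' at an arbitrary ρ, and the left side is at least s by hypothesis.
  obtain ⟨⟨V', D'⟩, ⟨-, σ', rfl⟩, φ, hφ, hlim⟩ :=
    ((isCompact_closedBall (0 : H →L[ℂ] H) 1).prod
      (isCompact_range_density (E := g))).tendsto_subseq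
      (x := fun n => (V n, (σ n).density))
      fun n => ⟨mem_closedBall_zero_iff.mpr (hVn n), σ n, rfl⟩
  have hV' : Filter.Tendsto (fun n => V (φ n)) Filter.atTop (nhds V') :=
    (continuous_fst.tendsto _).comp hlim
  have hσ' : Filter.Tendsto (fun n => (σ (φ n)).density) Filter.atTop (nhds σ'.density) :=
    (continuous_snd.tendsto _).comp hlim
  have hε0 : Filter.Tendsto (fun n => 1 / ((φ n : ℝ) + 1)) Filter.atTop (nhds 0) :=
    tendsto_one_div_add_atTop_nhds_zero_nat.comp hφ.tendsto_atTop
  have hzero : ∀ W D, (trace (W * ((X + (0 : ℝ) • 1) * Λ ((1 - (0 : ℝ)) • D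
      + (0 : ℝ) • τ.density) * (Y + (0 : ℝ) • 1)))).re
      = (trace (W ∘L X ∘L Λ D ∘L Y)).re := by
    intro W D
    simp only [zero_smul, add_zero, sub_zero, one_smul, mul_assoc]
    rfl
  have hcont := continuous_trace_sandwich Λ X Y τ.density
  refine ⟨V', ?_, fun ρ => ?_⟩
  · have hcl : IsClosed {B : H →L[ℂ] H | star B * B = 1} :=
      isClosed_eq (by fun_prop) continuous_const
    exact hcl.mem_of_tendsto hV' (Filter.Eventually.of_forall fun n => hV (φ n))
  · have h1 := (hcont.tendsto (0, W₀, σ'.density)).comp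
      (hε0.prodMk_nhds ((tendsto_const_nhds (x := W₀)).prodMk_nhds hσ'))
    have h2 := (hcont.tendsto (0, V', ρ.density)).comp
      (hε0.prodMk_nhds (hV'.prodMk_nhds (tendsto_const_nhds (x := ρ.density))))
    have h3 := le_of_tendsto_of_tendsto' h1 h2 fun n => hσ (φ n) ρ
    simp only [hzero] at h3
    exact (hs σ').trans h3

end Saddle

/-! ### Infima and suprema of k - f. -/

section Suprema

theorem iInf_const_sub {ι : Type*} [Nonempty ι] {f : ι → ℝ} {m : ℝ} (hf : ∀ i, f i ≤ m) (k : ℝ) :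
    ⨅ i, (k - f i) = k - ⨆ i, f i := by
  have hb : BddAbove (Set.range f) := ⟨m, by rintro _ ⟨i, rfl⟩; exact hf i⟩
  have hb' : BddBelow (Set.range fun i => k - f i) :=
    ⟨k - m, by rintro _ ⟨i, rfl⟩; exact sub_le_sub_left (hf i) k⟩
  refine le_antisymm ?_ (le_ciInf fun i => sub_le_sub_left (le_ciSup hb i) k)
  have : ⨆ i, f i ≤ k - ⨅ i, (k - f i) := ciSup_le fun i => by linarith [ciInf_le hb' i]
  linarith

theorem iSup_const_sub {ι : Type*} [Nonempty ι] {f : ι → ℝ} {m : ℝ} (hf : ∀ i, m ≤ f i) (k : ℝ) :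
    ⨆ i, (k - f i) = k - ⨅ i, f i := by
  have hb : BddBelow (Set.range f) := ⟨m, by rintro _ ⟨i, rfl⟩; exact hf i⟩
  have hb' : BddAbove (Set.range fun i => k - f i) :=
    ⟨k - m, by rintro _ ⟨i, rfl⟩; exact sub_le_sub_left (hf i) k⟩
  refine le_antisymm (ciSup_le fun i => sub_le_sub_left (ciInf_le hb i) k) ?_
  have : k - ⨆ i, (k - f i) ≤ ⨅ i, f i := le_ciInf fun i => by linarith [le_ciSup hb' i]
  linarith

end Suprema

/-! ### Overlaps of purifications. -/

section Purifications

variable {g : Type*} [NormedAddCommGroup g] [InnerProductSpace ℂ g] [CompleteSpace g]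
variable {h : Type*} [NormedAddCommGroup h] [InnerProductSpace ℂ h] [CompleteSpace h]
variable {Φτ Ψτ : HTensor g h →L[ℂ] HTensor g h} {a b : ℝ}

/-- The partial trace of the operator over `h` is `a • 1`, expressed on diagonal matrix elements. -/
def HasScalarMarginal (Φτ : HTensor g h →L[ℂ] HTensor g h) (a : ℝ) : Prop :=
  ∀ x : g, HasSum (fun k => inner ℂ (tmulVec x (stdBasis h k)) (Φτ (tmulVec x (stdBasis h k))))
    (((a * ‖x‖ ^ 2 : ℝ)) : ℂ)

theorem IsOperationalDensity.hasScalarMarginal {C : Conjugation h}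
    {Φ : (h →L[ℂ] h) →CP (g →L[ℂ] g)} (hΦτ : IsOperationalDensity C Φ Φτ)
    (hΦ : Φ 1 = (a : ℂ) • (1 : g →L[ℂ] g)) : HasScalarMarginal Φτ a := by
  intro x
  have := hΦτ.apply_eq 1 x x
  rw [transpose_one, opTensor_one_one, hΦ] at this
  simpa [inner_smul_right, inner_self_eq_norm_sq_to_K] using this

omit [CompleteSpace g] in
-- A scalar marginal makes F equal to √a times an isometry, which removes all dependence of ‖Γ(ρ ⊗
-- 1)^{1/2}‖ on Γ and ρ.
theorem Purification.exists_isFibre (hm : HasScalarMarginal Φτ a) (Γ : Purification Φτ) :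
    ∃ F : g →L[ℂ] FibreSpace h (HTensor g h), IsFibre Γ.1 F ∧ ∀ x, ‖F x‖ ^ 2 = a * ‖x‖ ^ 2 := by
  have hsum : ∀ x, HasSum (fun k => ‖Γ.1 (tmulVec x (stdBasis h k))‖ ^ 2) (a * ‖x‖ ^ 2) := by
    intro x
    have := (hm x).mapL Complex.reCLM
    simpa only [inner_self_apply_eq_norm_sq Γ.2, Complex.reCLM_apply, Complex.ofReal_re] using this
  obtain ⟨F, hF⟩ := QOp.exists_isFibre Γ.1 (√|a|) (fun x s => by
    refine (sum_le_hasSum s (fun _ _ => by positivity) (hsum x)).trans ?_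
    rw [mul_pow, Real.sq_sqrt (abs_nonneg a)]
    gcongr
    exact le_abs_self a)
  exact ⟨F, hF, fun x => (hF.hasSum_norm_sq x).unique (hsum x)⟩

theorem Purification.hasSum_norm_sq (hm : HasScalarMarginal Φτ a) (Γ : Purification Φτ)
    (ρ : NormalState g) :
    HasSum (fun p => ‖Γ.1 (opTensor ρ.amplitude 1 (prodBasis g h p))‖ ^ 2) a := by
  obtain ⟨F, hF, hFa⟩ := Γ.exists_isFibre hm
  have := hF.hasSum_norm_sq_state ρ
  simp only [hFa] at this
  rwa [tsum_mul_left, ρ.hasSum_norm_sq_amplitude.tsum_eq, mul_one] at this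

/-- The overlap `Re Tr (Υ (ρ ⊗ 1) Γ†)` of two operators at a state. -/
def overlap (Γ Υ : HTensor g h →L[ℂ] HTensor g h) (ρ : NormalState g) : ℝ :=
  (trace (Υ ∘L opTensor ρ.density 1 ∘L ContinuousLinearMap.adjoint Γ)).re

theorem Purification.overlap_eq_tsum (hm : HasScalarMarginal Φτ a) (hn : HasScalarMarginal Ψτ b)
    (Γ : Purification Φτ) (Υ : Purification Ψτ) (W : HTensor g h →L[ℂ] HTensor g h)
    (ρ : NormalState g) :
    overlap Γ.1 (W ∘L Υ.1) ρ
      = (∑' p, inner ℂ (Γ.1 (opTensor ρ.amplitude 1 (prodBasis g h p)))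
          (W (Υ.1 (opTensor ρ.amplitude 1 (prodBasis g h p))))).re := by
  obtain ⟨F, hF, -⟩ := Γ.exists_isFibre hm
  obtain ⟨G, hG, -⟩ := Υ.exists_isFibre hn
  obtain ⟨G', hG'⟩ := hG.exists_comp W
  rw [overlap, hF.trace_eq hG' ρ]
  rfl

theorem Purification.overlap_mix (hm : HasScalarMarginal Φτ a) (hn : HasScalarMarginal Ψτ b)
    (Γ : Purification Φτ) (Υ : Purification Ψτ) (W : HTensor g h →L[ℂ] HTensor g h)
    (ρ σ : NormalState g) (s t : ℝ) (hs : 0 ≤ s) (ht : 0 ≤ t) (hst : s + t = 1) :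
    overlap Γ.1 (W ∘L Υ.1) (ρ.mix σ s t hs ht hst)
      = s * overlap Γ.1 (W ∘L Υ.1) ρ + t * overlap Γ.1 (W ∘L Υ.1) σ := by
  obtain ⟨F, hF, -⟩ := Γ.exists_isFibre hm
  obtain ⟨G, hG, -⟩ := Υ.exists_isFibre hn
  obtain ⟨G', hG'⟩ := hG.exists_comp W
  have h1 := ((hF.hasSum_trace hG' ρ).mul_left (s : ℂ)).add
    ((hF.hasSum_trace hG' σ).mul_left (t : ℂ))
  rw [← hF.trace_eq hG' ρ, ← hF.trace_eq hG' σ] at h1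
  have hd : (ρ.mix σ s t hs ht hst).density = (s : ℂ) • ρ.density + (t : ℂ) • σ.density := by
    simp only [Complex.coe_smul]
    rfl
  have h2 : trace ((W ∘L Υ.1) ∘L opTensor (ρ.mix σ s t hs ht hst).density 1
      ∘L ContinuousLinearMap.adjoint Γ.1) = _ := HasSum.tsum_eq (by
    refine (congrArg (fun f => HasSum f _) (funext fun j => ?_)).mpr h1
    simp only [hd, opTensor_add_left, opTensor_smul_left, ContinuousLinearMap.comp_apply, add_apply,
      smul_apply, map_add, map_smul, inner_add_right, inner_smul_right])
  simp only [overlap, h2, Complex.add_re, Complex.re_ofReal_mul]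

theorem Purification.abs_overlap_le (hm : HasScalarMarginal Φτ a) (hn : HasScalarMarginal Ψτ b)
    (Γ : Purification Φτ) (Υ : Purification Ψτ) (ρ : NormalState g) :
    |overlap Γ.1 Υ.1 ρ| ≤ √a * √b := by
  have h1 := Γ.overlap_eq_tsum hm hn Υ 1 ρ
  have h2 : (1 : HTensor g h →L[ℂ] HTensor g h) ∘L Υ.1 = Υ.1 := one_mul Υ.1
  rw [h2] at h1
  rw [h1]
  refine (Complex.abs_re_le_norm _).trans ?_
  refine (norm_tsum_inner_le (Γ.hasSum_norm_sq hm ρ).summable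
    (Υ.hasSum_norm_sq hn ρ).summable).trans ?_
  rw [(Γ.hasSum_norm_sq hm ρ).tsum_eq, (Υ.hasSum_norm_sq hn ρ).tsum_eq]

/-- Expansion of the Hilbert–Schmidt square: the two quadratic terms are the constants a and b, so
only the cross term varies. -/
theorem Purification.cost_sub (hm : HasScalarMarginal Φτ a) (hn : HasScalarMarginal Ψτ b)
    (Γ : Purification Φτ) (Υ : Purification Ψτ) (ρ : NormalState g) :
    cost (Γ.1 - Υ.1) ρ = (a + b) / 2 - overlap Γ.1 Υ.1 ρ := by
  obtain ⟨F, hF, -⟩ := Γ.exists_isFibre hm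
  obtain ⟨G, hG, -⟩ := Υ.exists_isFibre hn
  have h1 := Γ.overlap_eq_tsum hm hn Υ 1 ρ
  have h2 : (1 : HTensor g h →L[ℂ] HTensor g h) ∘L Υ.1 = Υ.1 := one_mul Υ.1
  rw [h2] at h1
  have h3 := Γ.hasSum_norm_sq hm ρ
  have h4 := Υ.hasSum_norm_sq hn ρ
  have h5 := (summable_inner_of_norm_sq h3.summable h4.summable).hasSum.mapL Complex.reCLM
  have h6 := (h3.sub (h5.mul_left 2)).add h4
  have h7 := (hF.sub hG).hasSum_norm_sq_state ρ
  have h8 : (∑' i, ‖(F - G) (ρ.amplitude (stdBasis g i))‖ ^ 2) = _ := h7.unique (by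
    refine (congrArg (fun f => HasSum f _) (funext fun p => ?_)).mpr h6
    rw [sub_apply, norm_sub_sq (𝕜 := ℂ)]
    rfl)
  rw [(hF.sub hG).cost_eq, h8, h1]
  simp only [Complex.reCLM_apply, one_apply_eq_self]
  ring

/-- The square root is a purification. -/
def Purification.sqrt (hΦ : 0 ≤ Φτ) : Purification Φτ :=
  ⟨sqrtOp Φτ, by rw [adjoint_sqrtOp, sqrtOp_comp_sqrtOp hΦ]⟩

omit [CompleteSpace h] in
theorem Purification.overlap_sqrt (hΦ : 0 ≤ Φτ) (Z : HTensor g h →L[ℂ] HTensor g h)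
    (ρ : NormalState g) : overlap (sqrt hΦ).1 Z ρ
      = (trace (Z ∘L opTensor ρ.density 1 ∘L sqrtOp Φτ)).re := by
  simp only [overlap, sqrt, adjoint_sqrtOp]

omit [CompleteSpace g] [CompleteSpace h] in
theorem Purification.exists_contraction (Γ Y : Purification Φτ) :
    ∃ U : HTensor g h →L[ℂ] HTensor g h, ‖U‖ ≤ 1 ∧ U ∘L Y.1 = Γ.1 :=
  exists_contraction_comp_eq (norm_eq_of_adjoint_comp_eq (Γ.2.trans Y.2.symm))

/-- The purification `V Y` obtained from `Y` by applying an operator with `V† V = 1`. -/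
def Purification.isometryComp (Y : Purification Φτ) (V : HTensor g h →L[ℂ] HTensor g h)
    (hV : ContinuousLinearMap.adjoint V ∘L V = 1) : Purification Φτ :=
  ⟨V ∘L Y.1, by
    rw [ContinuousLinearMap.adjoint_comp, ContinuousLinearMap.comp_assoc,
      ← ContinuousLinearMap.comp_assoc _ V, hV]
    exact Y.2⟩

/-- If Γ = U Y and Υ = U' X, take W = U†U'; it does not depend on the state. -/
theorem Purification.exists_overlap_eq (hm : HasScalarMarginal Φτ a) (hn : HasScalarMarginal Ψτ b)
    (Y Γ : Purification Φτ) (X Υ : Purification Ψτ) :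
    ∃ W : HTensor g h →L[ℂ] HTensor g h, ‖W‖ ≤ 1 ∧
      ∀ ρ, overlap Γ.1 Υ.1 ρ = overlap Y.1 (W ∘L X.1) ρ := by
  obtain ⟨U, hU, hΓ⟩ := Γ.exists_contraction Y
  obtain ⟨U', hU', hΥ⟩ := Υ.exists_contraction X
  refine ⟨ContinuousLinearMap.adjoint U ∘L U', ?_, fun ρ => ?_⟩
  · refine (ContinuousLinearMap.opNorm_comp_le _ _).trans ?_
    rw [LinearIsometryEquiv.norm_map]
    nlinarith [norm_nonneg U, norm_nonneg U']
  · have h1 := Γ.overlap_eq_tsum hm hn X U' ρ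
    rw [hΥ] at h1
    rw [h1, Y.overlap_eq_tsum hm hn X _ ρ, ← hΓ]
    simp only [ContinuousLinearMap.comp_apply, ContinuousLinearMap.adjoint_inner_right]

/-- At a fixed state the overlap is real-linear in W, so unitaries approximate the value of any
contraction, and U X is a purification for unitary U. Only the second purification has to move. -/
theorem Purification.exists_overlap_ge_sub (hm : HasScalarMarginal Φτ a)
    (hn : HasScalarMarginal Ψτ b) (Y : Purification Φτ) (X : Purification Ψτ) (ρ : NormalState g)
    {W : HTensor g h →L[ℂ] HTensor g h} (hW : ‖W‖ ≤ 1) {ε : ℝ} (hε : 0 < ε) :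
    ∃ Υ : Purification Ψτ, overlap Y.1 (W ∘L X.1) ρ - ε ≤ overlap Y.1 Υ.1 ρ := by
  have hs : ∀ B : HTensor g h →L[ℂ] HTensor g h, Summable fun p =>
      inner ℂ (Y.1 (opTensor ρ.amplitude 1 (prodBasis g h p)))
        (B (X.1 (opTensor ρ.amplitude 1 (prodBasis g h p)))) := fun B =>
    summable_inner_of_norm_sq (Y.hasSum_norm_sq hm ρ).summable
      (summable_norm_sq_comp_left B (X.hasSum_norm_sq hn ρ).summable)
  let l : (HTensor g h →L[ℂ] HTensor g h) →ₗ[ℝ] ℝ :=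
    { toFun := fun B => overlap Y.1 (B ∘L X.1) ρ
      map_add' := fun B B' => by
        simp only [Y.overlap_eq_tsum hm hn X, add_apply, inner_add_right]
        rw [(hs B).tsum_add (hs B'), Complex.add_re]
      map_smul' := fun c B => by
        simp only [Y.overlap_eq_tsum hm hn X, ← Complex.coe_smul, smul_apply, inner_smul_right]
        rw [tsum_mul_left, Complex.re_ofReal_mul]
        simp }
  obtain ⟨U, hU, h⟩ := exists_unitary_ge_sub l (√a * √b) (fun U hU =>
    (le_abs_self _).trans (Y.abs_overlap_le hm hn
      (X.isometryComp U (Unitary.star_mul_self_of_mem hU)) ρ)) hW hε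
  exact ⟨X.isometryComp U (Unitary.star_mul_self_of_mem hU), h⟩

theorem Purification.exists_contraction_forall_overlap_ge (hm : HasScalarMarginal Φτ a)
    (hn : HasScalarMarginal Ψτ b) (Y : Purification Φτ) (X : Purification Ψτ) {c : ℝ}
    (hc : ∀ ρ, ∃ W : HTensor g h →L[ℂ] HTensor g h, ‖W‖ ≤ 1 ∧ c ≤ overlap Y.1 (W ∘L X.1) ρ) :
    ∃ W : HTensor g h →L[ℂ] HTensor g h, ‖W‖ ≤ 1 ∧ ∀ ρ, c ≤ overlap Y.1 (W ∘L X.1) ρ := by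
  have hmix := Y.overlap_mix hm hn X
  simp only [Y.overlap_eq_tsum hm hn X] at hc hmix ⊢
  exact exists_contraction_forall_ge _ _ (fun ρ => (Y.hasSum_norm_sq hm ρ).summable)
    (fun ρ => (X.hasSum_norm_sq hn ρ).summable)
    (fun ρ σ s t hs ht hst => ⟨_, fun W => hmix W ρ σ s t hs ht hst⟩) hc

/-- Return from the relaxed problem, uniformly in the state: dilation moves both purifications in
infinite dimension, a unitary moves only the second in finite dimension. -/
theorem Purification.exists_forall_overlap_ge [Nontrivial g] (hm : HasScalarMarginal Φτ a)
    (hn : HasScalarMarginal Ψτ b) (hΦ : 0 ≤ Φτ) (hΨ : 0 ≤ Ψτ)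
    {W : HTensor g h →L[ℂ] HTensor g h} (hW : ‖W‖ ≤ 1) {c : ℝ}
    (hc : ∀ ρ, c ≤ overlap (sqrt hΦ).1 (W ∘L (sqrt hΨ).1) ρ) :
    ∃ (Γ : Purification Φτ) (Υ : Purification Ψτ), ∀ ρ, c ≤ overlap Γ.1 Υ.1 ρ := by
  by_cases hH : FiniteDimensional ℂ (HTensor g h)
  · rcases subsingleton_or_nontrivial h with hh | hh
    · have hsub : Subsingleton (HTensor g h →L[ℂ] HTensor g h) :=
        ⟨fun S T => clm_ext_tmulVec fun x y => by
          have : tmulVec x y = 0 := by rw [← norm_eq_zero, norm_tmulVec, Subsingleton.elim y 0]; simp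
          rw [this, map_zero, map_zero]⟩
      refine ⟨sqrt hΦ, sqrt hΨ, fun ρ => ?_⟩
      rw [← Subsingleton.elim (W ∘L (sqrt hΨ).1) (sqrt hΨ).1]
      exact hc ρ
    · obtain ⟨y, hy⟩ := exists_ne (0 : h)
      have hg : FiniteDimensional ℂ g := by
        refine FiniteDimensional.of_injective (tmulLeft y : g →L[ℂ] HTensor g h).toLinearMap ?_
        refine (injective_iff_map_eq_zero _).mpr fun x hx => ?_
        have h1 : tmulVec x y = 0 := hx
        rw [← norm_eq_zero, norm_tmulVec, mul_eq_zero, norm_eq_zero, norm_eq_zero] at h1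
        exact h1.resolve_right hy
      simp only [overlap_sqrt] at hc
      obtain ⟨V, hV, h⟩ := exists_unitary_forall_trace_ge (opTensorLeft g h)
        (fun A hA => isUnit_opTensor_one hA) (sqrtOp_nonneg Ψτ) (sqrtOp_nonneg Φτ) hW (s := c) hc
      refine ⟨sqrt hΦ, (sqrt hΨ).isometryComp V hV, fun ρ => ?_⟩
      rw [overlap_sqrt]
      exact h ρ
  · obtain ⟨J, V, hJ, hV, hJV⟩ := exists_dilation hH hW
    refine ⟨(sqrt hΦ).isometryComp J hJ, (sqrt hΨ).isometryComp V hV, fun ρ => ?_⟩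
    refine (hc ρ).trans_eq ?_
    rw [(sqrt hΦ).overlap_eq_tsum hm hn (sqrt hΨ) W, ← hJV]
    refine Eq.trans ?_ (((sqrt hΦ).isometryComp J hJ).overlap_eq_tsum hm hn (sqrt hΨ) V ρ).symm
    simp only [isometryComp, ContinuousLinearMap.comp_apply,
      ContinuousLinearMap.adjoint_inner_right]

end Purifications

/-! ### The norm of an operation with scalar marginal. -/

section OperationNorm

variable {g : Type*} [NormedAddCommGroup g] [InnerProductSpace ℂ g] [CompleteSpace g]
variable {h : Type*} [NormedAddCommGroup h] [InnerProductSpace ℂ h] [CompleteSpace h]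
variable {Φτ : HTensor g h →L[ℂ] HTensor g h} {a : ℝ}

/-- With Φτ = Y†Y and T the adjoint of the transpose of B, the matrix element is Σ ⟨Y(x ⊗ T k), Y(x'
⊗ k)⟩. Cauchy–Schwarz applies; passing to adjoints shows that composing with T on the right
multiplies the Hilbert–Schmidt norm by at most ‖B‖. -/
theorem IsOperationalDensity.norm_inner_apply_le {C : Conjugation h}
    {Φ : (h →L[ℂ] h) →CP (g →L[ℂ] g)} (hΦτ : IsOperationalDensity C Φ Φτ) (ha : 0 ≤ a)
    (hm : HasScalarMarginal Φτ a) (B : h →L[ℂ] h) (x x' : g) :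
    ‖inner ℂ x (Φ B x')‖ ≤ a * ‖B‖ * ‖x‖ * ‖x'‖ := by
  set Y := Purification.sqrt hΦτ.nonneg
  obtain ⟨F, hF, hFa⟩ := Y.exists_isFibre hm
  set T := ContinuousLinearMap.adjoint (transpose C B)
  have hG : ∀ z, HasSum (fun k => ‖(Y.1 ∘L tmulRight z) (stdBasis h k)‖ ^ 2) (a * ‖z‖ ^ 2) :=
    fun z => by simpa [hFa] using hF.hasSum_norm_sq z
  have hTn : ‖ContinuousLinearMap.adjoint T‖ ≤ ‖B‖ := by
    rw [ContinuousLinearMap.adjoint_adjoint]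
    exact norm_transpose_le C B
  have hs : HasSum (fun j => ‖ContinuousLinearMap.adjoint (Y.1 ∘L tmulRight x)
      (stdBasis (HTensor g h) j)‖ ^ 2) (a * ‖x‖ ^ 2) :=
    hasSum_norm_sq_adjoint (stdBasis h) (stdBasis (HTensor g h)) _ (hG x)
  have hs2 := (summable_norm_sq_comp_left (ContinuousLinearMap.adjoint T) hs.summable).hasSum
  have hle : ∑' j, ‖ContinuousLinearMap.adjoint T (ContinuousLinearMap.adjoint
      (Y.1 ∘L tmulRight x) (stdBasis (HTensor g h) j))‖ ^ 2 ≤ ‖B‖ ^ 2 * (a * ‖x‖ ^ 2) := by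
    refine hasSum_le (fun j => ?_) hs2 (hs.mul_left _)
    rw [← mul_pow]
    refine pow_le_pow_left₀ (norm_nonneg _) (((ContinuousLinearMap.adjoint T).le_opNorm _).trans ?_) 2
    gcongr
  have hs3 : HasSum (fun k => ‖((Y.1 ∘L tmulRight x) ∘L T) (stdBasis h k)‖ ^ 2)
      (∑' j, ‖ContinuousLinearMap.adjoint T (ContinuousLinearMap.adjoint
        (Y.1 ∘L tmulRight x) (stdBasis (HTensor g h) j))‖ ^ 2) := by
    have := hasSum_norm_sq_adjoint (stdBasis (HTensor g h)) (stdBasis h)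
      (ContinuousLinearMap.adjoint T ∘L ContinuousLinearMap.adjoint (Y.1 ∘L tmulRight x)) hs2
    rwa [← ContinuousLinearMap.adjoint_comp, ContinuousLinearMap.adjoint_adjoint] at this
  have hpt := hΦτ.apply_eq B x x'
  have e : ∀ k, inner ℂ (tmulVec x (stdBasis h k))
      ((opTensor 1 (transpose C B) ∘L Φτ) (tmulVec x' (stdBasis h k)))
      = inner ℂ (((Y.1 ∘L tmulRight x) ∘L T) (stdBasis h k))
        ((Y.1 ∘L tmulRight x') (stdBasis h k)) := by
    intro k
    rw [ContinuousLinearMap.comp_apply, ← ContinuousLinearMap.adjoint_inner_left, adjoint_opTensor,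
      opTensor_tmulVec, ← congrArg (fun S => S (tmulVec x' (stdBasis h k))) Y.2,
      ContinuousLinearMap.comp_apply, ContinuousLinearMap.adjoint_inner_right,
      ← ContinuousLinearMap.star_eq_adjoint 1, star_one]
    rfl
  simp only [e] at hpt
  rw [← hpt.tsum_eq]
  refine (norm_tsum_inner_le hs3.summable (hG x').summable).trans ?_
  rw [hs3.tsum_eq, (hG x').tsum_eq]
  calc _ ≤ √(‖B‖ ^ 2 * (a * ‖x‖ ^ 2)) * √(a * ‖x'‖ ^ 2) := by gcongr
    _ = a * ‖B‖ * ‖x‖ * ‖x'‖ := by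
      rw [← Real.sqrt_mul (by positivity)]
      have : ‖B‖ ^ 2 * (a * ‖x‖ ^ 2) * (a * ‖x'‖ ^ 2) = (a * ‖B‖ * ‖x‖ * ‖x'‖) ^ 2 := by ring
      rw [this, Real.sqrt_sq (by positivity)]

theorem IsOperationalDensity.opNorm_eq [Nontrivial g] {C : Conjugation h}
    {Φ : (h →L[ℂ] h) →CP (g →L[ℂ] g)} (hΦτ : IsOperationalDensity C Φ Φτ) (ha : 0 ≤ a)
    (hΦ : Φ 1 = (a : ℂ) • (1 : g →L[ℂ] g)) : opNorm Φ = a := by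
  have hm := hΦτ.hasScalarMarginal hΦ
  refine le_antisymm ?_ ?_
  · refine ContinuousLinearMap.opNorm_le_bound _ ha fun B => ?_
    refine ContinuousLinearMap.opNorm_le_bound _ (by positivity) fun x' => ?_
    have h1 := hΦτ.norm_inner_apply_le ha hm B (Φ B x') x'
    change ‖Φ B x'‖ ≤ a * ‖B‖ * ‖x'‖
    rw [inner_self_eq_norm_sq_to_K] at h1
    simp only [norm_pow, RCLike.norm_ofReal, abs_norm] at h1
    by_cases h0 : ‖Φ B x'‖ = 0
    · rw [h0]; positivity
    have h2 : 0 < ‖Φ B x'‖ := lt_of_le_of_ne (norm_nonneg _) (Ne.symm h0)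
    nlinarith
  · have h1 := ContinuousLinearMap.le_opNorm
      (⟨Φ.toLinearMap, map_continuous Φ⟩ : (h →L[ℂ] h) →L[ℂ] (g →L[ℂ] g)) 1
    change ‖Φ 1‖ ≤ opNorm Φ * _ at h1
    rw [hΦ, norm_smul, norm_one, mul_one, Complex.norm_real, Real.norm_of_nonneg ha] at h1
    -- Only an inequality, since h may be zero.
    have h2 : ‖(1 : h →L[ℂ] h)‖ ≤ 1 := ContinuousLinearMap.norm_id_le
    have h3 : 0 ≤ opNorm Φ := norm_nonneg _
    nlinarith

end OperationNorm

/-! ### The distances and the fidelity in terms of overlaps. -/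

section Hellinger

variable {g : Type*} [NormedAddCommGroup g] [InnerProductSpace ℂ g] [CompleteSpace g]
variable {h : Type*} [NormedAddCommGroup h] [InnerProductSpace ℂ h] [CompleteSpace h]
variable {Φτ Ψτ : HTensor g h →L[ℂ] HTensor g h} {a b : ℝ}

theorem hellingerSq_eq_hellingerSqMinimax [Nontrivial g] (hm : HasScalarMarginal Φτ a)
    (hn : HasScalarMarginal Ψτ b) : hellingerSq Φτ Ψτ = hellingerSqMinimax Φτ Ψτ := by
  rw [hellingerSq, hellingerSqMinimax, iInf]
  congr 1
  ext r
  constructor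
  · rintro ⟨Γ, Υ, D, hD, rfl⟩
    obtain ⟨F, hF, -⟩ := Γ.exists_isFibre hm
    obtain ⟨G, hG, -⟩ := Υ.exists_isFibre hn
    exact ⟨(Γ, Υ), ((hF.sub hG).norm_eq_of_isPartialTrace hD).symm⟩
  · rintro ⟨⟨Γ, Υ⟩, rfl⟩
    obtain ⟨F, hF, -⟩ := Γ.exists_isFibre hm
    obtain ⟨G, hG, -⟩ := Υ.exists_isFibre hn
    exact ⟨Γ, Υ, _, (hF.sub hG).isPartialTrace,
      ((hF.sub hG).norm_eq_of_isPartialTrace (hF.sub hG).isPartialTrace).symm⟩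

/-- Any pair is replaced by a contraction between the square roots, which unitaries acting on the
second one approximate within ε. -/
theorem iSup_overlap_sqrt_eq (hm : HasScalarMarginal Φτ a) (hn : HasScalarMarginal Ψτ b)
    (hΦ : 0 ≤ Φτ) (hΨ : 0 ≤ Ψτ) (ρ : NormalState g) :
    ⨆ Υ : Purification Ψτ, overlap (Purification.sqrt hΦ).1 Υ.1 ρ
      = ⨆ p : Purification Φτ × Purification Ψτ, overlap p.1.1 p.2.1 ρ := by
  have : Nonempty (Purification Φτ) := ⟨.sqrt hΦ⟩
  have : Nonempty (Purification Ψτ) := ⟨.sqrt hΨ⟩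
  have hb : ∀ p : Purification Φτ × Purification Ψτ, overlap p.1.1 p.2.1 ρ ≤ √a * √b := fun p =>
    (le_abs_self _).trans (p.1.abs_overlap_le hm hn p.2 ρ)
  have hB : BddAbove (Set.range fun p : Purification Φτ × Purification Ψτ =>
    overlap p.1.1 p.2.1 ρ) := ⟨_, by rintro _ ⟨p, rfl⟩; exact hb p⟩
  have hB' : BddAbove (Set.range fun Υ : Purification Ψτ =>
    overlap (Purification.sqrt hΦ).1 Υ.1 ρ) := ⟨_, by rintro _ ⟨Υ, rfl⟩; exact hb (_, Υ)⟩
  refine le_antisymm (ciSup_le fun Υ => le_ciSup hB (Purification.sqrt hΦ, Υ)) ?_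
  refine ciSup_le fun p => le_of_forall_pos_le_add fun ε hε => ?_
  obtain ⟨W, hW, he⟩ := Purification.exists_overlap_eq hm hn (.sqrt hΦ) p.1 (.sqrt hΨ) p.2
  obtain ⟨Υ, hΥ⟩ := Purification.exists_overlap_ge_sub hm hn (.sqrt hΦ) (.sqrt hΨ) ρ hW hε
  rw [he ρ]
  linarith [le_ciSup hB' Υ]

theorem iSup_iInf_overlap_eq [Nontrivial g] (hm : HasScalarMarginal Φτ a) (hn : HasScalarMarginal Ψτ b)
    (hΦ : 0 ≤ Φτ) (hΨ : 0 ≤ Ψτ) :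
    ⨆ p : Purification Φτ × Purification Ψτ, ⨅ ρ : NormalState g, overlap p.1.1 p.2.1 ρ
      = ⨅ ρ : NormalState g, ⨆ p : Purification Φτ × Purification Ψτ, overlap p.1.1 p.2.1 ρ := by
  have : Nonempty (Purification Φτ) := ⟨.sqrt hΦ⟩
  have : Nonempty (Purification Ψτ) := ⟨.sqrt hΨ⟩
  have hb := fun (p : Purification Φτ × Purification Ψτ) (ρ : NormalState g) =>
    abs_le.mp (p.1.abs_overlap_le hm hn p.2 ρ)
  have hB : ∀ ρ : NormalState g, BddAbove (Set.range fun p : Purification Φτ × Purification Ψτ =>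
    overlap p.1.1 p.2.1 ρ) := fun ρ => ⟨_, by rintro _ ⟨p, rfl⟩; exact (hb p ρ).2⟩
  have hB' : ∀ p : Purification Φτ × Purification Ψτ, BddBelow (Set.range fun ρ : NormalState g =>
    overlap p.1.1 p.2.1 ρ) := fun p => ⟨_, by rintro _ ⟨ρ, rfl⟩; exact (hb p ρ).1⟩
  have hC : BddAbove (Set.range fun p : Purification Φτ × Purification Ψτ =>
      ⨅ ρ : NormalState g, overlap p.1.1 p.2.1 ρ) := by
    refine ⟨√a * √b, ?_⟩
    rintro _ ⟨p, rfl⟩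
    exact (ciInf_le (hB' p) (Classical.arbitrary _)).trans (hb p _).2
  have hC' : BddBelow (Set.range fun ρ : NormalState g =>
      ⨆ p : Purification Φτ × Purification Ψτ, overlap p.1.1 p.2.1 ρ) := by
    refine ⟨-(√a * √b), ?_⟩
    rintro _ ⟨ρ, rfl⟩
    exact (hb (Classical.arbitrary _) ρ).1.trans (le_ciSup (hB ρ) _)
  refine le_antisymm (ciSup_le fun p => le_ciInf fun ρ =>
    (ciInf_le (hB' p) ρ).trans (le_ciSup (hB ρ) p)) ?_
  refine le_of_forall_lt fun c hc => ?_
  obtain ⟨c', hcc', hc'⟩ := exists_between hc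
  refine lt_of_lt_of_le hcc' ?_
  -- Below the inf-sup each state has its own good pair, hence its own contraction; minimax supplies
  -- a common one.
  obtain ⟨W, hW, hWc⟩ := Purification.exists_contraction_forall_overlap_ge hm hn
    (.sqrt hΦ) (.sqrt hΨ) (c := c') (fun ρ => by
      obtain ⟨p, hp⟩ := exists_lt_of_lt_ciSup (hc'.trans_le (ciInf_le hC' ρ))
      obtain ⟨W, hW, he⟩ := Purification.exists_overlap_eq hm hn (.sqrt hΦ) p.1 (.sqrt hΨ) p.2
      exact ⟨W, hW, by rw [← he ρ]; exact hp.le⟩)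
  obtain ⟨Γ, Υ, h⟩ := Purification.exists_forall_overlap_ge hm hn hΦ hΨ hW hWc
  exact (le_ciInf h).trans (le_ciSup hC (Γ, Υ))

theorem hellingerSqAt_eq (hm : HasScalarMarginal Φτ a) (hn : HasScalarMarginal Ψτ b)
    (hΦ : 0 ≤ Φτ) (hΨ : 0 ≤ Ψτ) (ρ : NormalState g) :
    hellingerSqAt Φτ Ψτ ρ = (a + b) / 2
      - ⨆ p : Purification Φτ × Purification Ψτ, overlap p.1.1 p.2.1 ρ := by
  have : Nonempty (Purification Φτ) := ⟨.sqrt hΦ⟩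
  have : Nonempty (Purification Ψτ) := ⟨.sqrt hΨ⟩
  rw [hellingerSqAt, ← iInf_const_sub (m := √a * √b) fun p =>
    (abs_le.mp (p.1.abs_overlap_le hm hn p.2 ρ)).2]
  exact iInf_congr fun p => p.1.cost_sub hm hn p.2 ρ

theorem iSup_hellingerSqAt_eq [Nontrivial g] (hm : HasScalarMarginal Φτ a) (hn : HasScalarMarginal Ψτ b)
    (hΦ : 0 ≤ Φτ) (hΨ : 0 ≤ Ψτ) :
    ⨆ ρ : NormalState g, hellingerSqAt Φτ Ψτ ρ = (a + b) / 2
      - ⨅ ρ : NormalState g, ⨆ p : Purification Φτ × Purification Ψτ, overlap p.1.1 p.2.1 ρ := by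
  rw [← iSup_const_sub (m := -(√a * √b)) fun ρ =>
    (abs_le.mp ((Purification.sqrt hΦ).abs_overlap_le hm hn (.sqrt hΨ) ρ)).1.trans
      (le_ciSup (f := fun p : Purification Φτ × Purification Ψτ => overlap p.1.1 p.2.1 ρ)
        ⟨√a * √b, by rintro _ ⟨p, rfl⟩; exact (abs_le.mp (p.1.abs_overlap_le hm hn p.2 ρ)).2⟩
        (.sqrt hΦ, .sqrt hΨ))]
  exact iSup_congr fun ρ => hellingerSqAt_eq hm hn hΦ hΨ ρ

theorem hellingerSqMinimax_eq [Nontrivial g] (hm : HasScalarMarginal Φτ a) (hn : HasScalarMarginal Ψτ b)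
    (hΦ : 0 ≤ Φτ) (hΨ : 0 ≤ Ψτ) :
    hellingerSqMinimax Φτ Ψτ = (a + b) / 2
      - ⨆ p : Purification Φτ × Purification Ψτ, ⨅ ρ : NormalState g, overlap p.1.1 p.2.1 ρ := by
  have : Nonempty (Purification Φτ) := ⟨.sqrt hΦ⟩
  have : Nonempty (Purification Ψτ) := ⟨.sqrt hΨ⟩
  have hb := fun (p : Purification Φτ × Purification Ψτ) (ρ : NormalState g) =>
    abs_le.mp (p.1.abs_overlap_le hm hn p.2 ρ)
  rw [hellingerSqMinimax, ← iInf_const_sub (m := √a * √b) fun p =>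
    (ciInf_le ⟨-(√a * √b), by rintro _ ⟨ρ, rfl⟩; exact (hb p ρ).1⟩
      (Classical.arbitrary _)).trans (hb p _).2]
  refine iInf_congr fun p => ?_
  rw [← iSup_const_sub (m := -(√a * √b)) fun ρ => (hb p ρ).1]
  exact iSup_congr fun ρ => p.1.cost_sub hm hn p.2 ρ

theorem minimaxFidelity_eq (C : Conjugation g) (Φ Ψ : (h →L[ℂ] h) →CP (g →L[ℂ] g)) :
    minimaxFidelity C Φ Ψ Φτ Ψτ = ⨅ ρ : NormalState g, ⨆ Υ : Purification Ψτ,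
      (trace (Υ.1 ∘L opTensor ρ.density 1 ∘L sqrtOp Φτ)).re /
        (√((ρ.eval C (Φ 1)).re) * √((ρ.eval C (Ψ 1)).re)) := rfl

theorem sqrt_mul_minimaxFidelity [Nontrivial g] (C : Conjugation g) {Φ Ψ : (h →L[ℂ] h) →CP (g →L[ℂ] g)}
    (hm : HasScalarMarginal Φτ a) (hn : HasScalarMarginal Ψτ b) (ha : 0 ≤ a)
    (hΦ : 0 ≤ Φτ) (hΨ : 0 ≤ Ψτ) (hΦe : ∀ ρ : NormalState g, ρ.eval C (Φ 1) = a)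
    (hΨe : ∀ ρ : NormalState g, ρ.eval C (Ψ 1) = b) :
    √(a * b) * minimaxFidelity C Φ Ψ Φτ Ψτ
      = ⨅ ρ : NormalState g, ⨆ p : Purification Φτ × Purification Ψτ, overlap p.1.1 p.2.1 ρ := by
  have : Nonempty (Purification Φτ) := ⟨.sqrt hΦ⟩
  have : Nonempty (Purification Ψτ) := ⟨.sqrt hΨ⟩
  rw [Real.sqrt_mul ha, minimaxFidelity_eq, Real.mul_iInf_of_nonneg (by positivity)]
  refine iInf_congr fun ρ => ?_
  rw [Real.mul_iSup_of_nonneg (by positivity), ← iSup_overlap_sqrt_eq hm hn hΦ hΨ]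
  refine iSup_congr fun Υ => ?_
  rw [hΦe, hΨe, Complex.ofReal_re, Complex.ofReal_re]
  rw [← Purification.overlap_sqrt hΦ]
  -- When the denominator vanishes, division returns 0, and the overlap is 0 as well, being bounded
  -- by √a √b.
  by_cases h0 : √a * √b = 0
  · have := (Purification.sqrt hΦ).abs_overlap_le hm hn Υ ρ
    rw [h0] at this
    rw [h0, zero_mul, abs_nonpos_iff.mp this]
  · rw [mul_div_cancel₀ _ h0]

end Hellinger

end QOp

end

/-! ### The main theorem. -/

theorem theorem1
    {g : Type*} [NormedAddCommGroup g] [InnerProductSpace ℂ g] [CompleteSpace g]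
    [TopologicalSpace.SeparableSpace g] [Nontrivial g]
    {h : Type*} [NormedAddCommGroup h] [InnerProductSpace ℂ h] [CompleteSpace h]
    [TopologicalSpace.SeparableSpace h]
    (Cg : QOp.Conjugation g) (Ch : QOp.Conjugation h)
    (Φ Ψ : CompletelyPositiveMap (h →L[ℂ] h) (g →L[ℂ] g))
    (hΦ : QOp.IsQuantumOperation Φ) (hΨ : QOp.IsQuantumOperation Ψ)
    (Φτ Ψτ : QOp.HTensor g h →L[ℂ] QOp.HTensor g h)
    (hΦτ : QOp.IsOperationalDensity Ch Φ Φτ) (hΨτ : QOp.IsOperationalDensity Ch Ψ Ψτ)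
    (hΦc : ∀ ρ ρ' : QOp.NormalState g, ρ.eval Cg (Φ 1) = ρ'.eval Cg (Φ 1))
    (hΨc : ∀ ρ ρ' : QOp.NormalState g, ρ.eval Cg (Ψ 1) = ρ'.eval Cg (Ψ 1)) :
    QOp.hellingerSq Φτ Ψτ = QOp.hellingerSqMinimax Φτ Ψτ ∧
    QOp.hellingerSqMinimax Φτ Ψτ =
      (⨆ ρ : QOp.NormalState g, QOp.hellingerSqAt Φτ Ψτ ρ) ∧
    QOp.hellingerSq Φτ Ψτ
        + √(QOp.opNorm Φ * QOp.opNorm Ψ) * QOp.minimaxFidelity Cg Φ Ψ Φτ Ψτ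
      = (QOp.opNorm Φ + QOp.opNorm Ψ) / 2 ∧
    (Φ 1 = 1 → Ψ 1 = 1 →
      QOp.hellingerSq Φτ Ψτ = 1 - QOp.minimaxFidelity Cg Φ Ψ Φτ Ψτ) := by
  have hΦ0 : 0 ≤ Φ 1 := map_nonneg Φ zero_le_one
  have hΨ0 : 0 ≤ Ψ 1 := map_nonneg Ψ zero_le_one
  obtain ⟨a, ha, hΦ1, hΦe⟩ := QOp.exists_eq_smul_one_of_eval_const Cg hΦ0 hΦc
  obtain ⟨b, hb, hΨ1, hΨe⟩ := QOp.exists_eq_smul_one_of_eval_const Cg hΨ0 hΨc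
  have hm := hΦτ.hasScalarMarginal hΦ1
  have hn := hΨτ.hasScalarMarginal hΨ1
  have h1 := QOp.hellingerSq_eq_hellingerSqMinimax hm hn
  have h2 := QOp.hellingerSqMinimax_eq hm hn hΦτ.nonneg hΨτ.nonneg
  have h3 := QOp.iSup_hellingerSqAt_eq hm hn hΦτ.nonneg hΨτ.nonneg
  have h4 := QOp.iSup_iInf_overlap_eq hm hn hΦτ.nonneg hΨτ.nonneg
  have h5 := QOp.sqrt_mul_minimaxFidelity Cg hm hn ha hΦτ.nonneg hΨτ.nonneg hΦe hΨe
  have hna := hΦτ.opNorm_eq ha hΦ1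
  have hnb := hΨτ.opNorm_eq hb hΨ1
  have hmain : QOp.hellingerSq Φτ Ψτ + √(a * b) * QOp.minimaxFidelity Cg Φ Ψ Φτ Ψτ
      = (a + b) / 2 := by
    rw [h1, h2, h4, h5, sub_add_cancel]
  refine ⟨h1, by rw [h2, h3, h4], by rw [hna, hnb]; exact hmain, fun hΦu hΨu => ?_⟩
  obtain ⟨ρ⟩ : Nonempty (QOp.NormalState g) := inferInstance
  have hone : ∀ c : ℝ, (1 : g →L[ℂ] g) = (c : ℂ) • 1 → c = 1 := by
    intro c hc
    obtain ⟨x, hx⟩ := exists_ne (0 : g)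
    have := DFunLike.congr_fun hc x
    simp only [one_apply_eq_self, smul_apply] at this
    have h6 : ((c : ℂ) - 1) • x = 0 := by rw [sub_smul, one_smul, ← this, sub_self]
    have h7 := (smul_eq_zero.mp h6).resolve_right hx
    exact_mod_cast sub_eq_zero.mp h7
  rw [hone a (hΦu ▸ hΦ1), hone b (hΨu ▸ hΨ1)] at hmain
  simp only [mul_one, Real.sqrt_one, one_mul] at hmain
  linarith
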